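/- Let $n\ge 0$. A two-dimensional Coxeter system $(X,f,g)$ consists of a set $X$ and functions $f\colon\binom X2\to\mathbb N$ and $g\colon\binom X3\to\mathbb N$, where $\mathbb N$ contains $0$. Its group $\langle X,f,g\rangle$ has generators $X$ and defining relations $x^2=e$, $(xy)^{f(x,y)}=e$, $(xyz)^{g(x,y,z)}=e$ for pairwise distinct $x,y,z\in X$. Let $A_{2,n}$ be the system on $X=\{x_1,\dots,x_n,y_1,\dots,y_n\}$ with $$f(x_i,x_{i+1})=f(y_i,y_{i+1})=4,\qquad f(x_i,y_i)=3,\qquad f=2\text{ on all other pairs},$$ $$g(x_i,x_{i+1},y_i)=g(x_i,x_{i+1},y_{i+1})=g(x_i,y_i,y_{i+1})=g(x_{i+1},y_i,y_{i+1})=3,$$ $$g(x_i,x_{i+1},x_{i+2})=g(y_i,y_{i+1},y_{i+2})=4,\qquad g=0\text{ on all other triples}.$$ For $S\subseteq X$ let $A_{2,n}(S)$ be the system on $S$ obtained by restricting $f$ and $g$. For a composition $\lambda=(\lambda_1,\dots,\lambda_l)$ of $n+1$ (all $\lambda_i\ge1$) let $P_\lambda\le \mathrm{GL}_{n+1}(\mathbb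 F_2)$ be the subgroup of invertible block upper triangular matrices with diagonal blocks of sizes $\lambda_1,\dots,\lambda_l$, and let $\overline s(\lambda)=\{\lambda_1,\lambda_1+\lambda_2,\dots,\lambda_1+\dots+\lambda_{l-1}\}$. For compositions $\lambda,\mu$ of $n+1$ put $P_{\lambda|\mu}=P_\lambda\cap P_\mu^{t}$, where $P_\mu^t=\{A^t: A\in P_\mu\}$, and $S_{\lambda|\mu}=\{x_i: i\notin\overline s(\lambda)\}\cup\{y_j: j\notin\overline s(\mu)\}$. A numbered family of distinct elements $a_1,\dots,a_r$ of a group is a local generating system of depth $k$ if it generates the group and $a_ia_j=a_ja_i$ whenever $|i-j|\ge k$. Then for all compositions $\lambda,\mu$ of $n+1$ there is an isomorphism $\langle A_{2,n}(S_{\lambda|\mu})\rangle\cong P_{\lambda|\mu}$ sending each generator $x_i\in S_{\lambda|\mu}$ to $I+E_{i+1,i}$ and each generator $y_j\in S_{\lambda|\mu}$ to $I+E_{j,j+1}$, and the generators $S_{\lambda|\mu}$ of $\langle A_{2,n}(S_{\lambda|\mu})\rangle$ can be numbered so that they form a local generating system of depth $3$. In particular, the same assignments give isomorphisms $\langle A_{2,n}\rangle\cong\mathrm{GL}_{n+1}(\mathbb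 F_2)$ and $\langle A_{2,n}(\{y_1,\dots,y_n\})\rangle\cong U_{n+1}(\mathbb F_2)$, the group of upper unitriangular matrices, and the generators of these two groups can also be numbered so as to form a local generating system of depth $3$. -/

import Mathlib

/-- A two-dimensional Coxeter system on a set `X`: a label `f x y` for every 2-subset `{x, y}` and
a label `g x y z` for every 3-subset `{x, y, z}` of `X`, encoded as symmetric functions. Only the
values at pairwise distinct arguments are ever used. -/
structure TwoDimCoxeterSystem (X : Type*) where
  f : X → X → ℕ
  g : X → X → X → ℕ
  f_symm : ∀ x y, f x y = f y x
  g_swap_left : ∀ x y z, g x y z = g y x z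
  g_swap_right : ∀ x y z, g x y z = g x z y

namespace TwoDimCoxeterSystem

variable {X : Type*} (A : TwoDimCoxeterSystem X)

/-- The defining relators `x ^ 2`, `(x y) ^ f(x, y)` and `(x y z) ^ g(x, y, z)`. -/
def relators : Set (FreeGroup X) :=
  {r | ∃ x, r = FreeGroup.of x ^ 2} ∪
  {r | ∃ x y, x ≠ y ∧ r = (FreeGroup.of x * FreeGroup.of y) ^ A.f x y} ∪
  {r | ∃ x y z, x ≠ y ∧ x ≠ z ∧ y ≠ z ∧
    r = (FreeGroup.of x * FreeGroup.of y * FreeGroup.of z) ^ A.g x y z}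

/-- The group `⟨X, f, g⟩` with generators `X` and the above defining relators. -/
abbrev Grp : Type _ := PresentedGroup A.relators

/-- The generator of `⟨X, f, g⟩` given by an element of `X`. -/
def gen (x : X) : A.Grp := PresentedGroup.of x

/-- Restriction of the labels to a subset `S` of `X`. -/
def restrict (S : Set X) : TwoDimCoxeterSystem S where
  f x y := A.f x y
  g x y z := A.g x y z
  f_symm x y := A.f_symm x y
  g_swap_left x y z := A.g_swap_left x y z
  g_swap_right x y z := A.g_swap_right x y z

end TwoDimCoxeterSystem

/-- `a 0, …, a (r - 1)` is a local generating system of depth `k`: the elements are distinct, they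
generate `G`, and those whose indices differ by at least `k` commute. -/
def IsLocalGeneratingSystem {G : Type*} [Group G] {r : ℕ} (k : ℕ) (a : Fin r → G) : Prop :=
  Function.Injective a ∧ Subgroup.closure (Set.range a) = ⊤ ∧
    ∀ i j : Fin r, (i : ℕ) + k ≤ (j : ℕ) → a i * a j = a j * a i

/-- The presentation `⟨X, f, g⟩` is local of depth `k`: its generators can be numbered so that they
form a local generating system of depth `k`. -/
def TwoDimCoxeterSystem.IsLocalOfDepth {X : Type*} (A : TwoDimCoxeterSystem X) (k : ℕ) : Prop :=
  ∃ (r : ℕ) (σ : Fin r ≃ X), IsLocalGeneratingSystem k (fun i => A.gen (σ i))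

/-- The generators `x_1, …, x_n, y_1, …, y_n`; the index `i : Fin n` stands for `i + 1`. -/
inductive XY (n : ℕ) : Type
  | x (i : Fin n) : XY n
  | y (i : Fin n) : XY n

/-- The edge labels of `A_{2,n}`. -/
def edgeLabel {n : ℕ} : XY n → XY n → ℕ
  | .x i, .x j => if (i : ℕ) + 1 = j ∨ (j : ℕ) + 1 = i then 4 else 2
  | .y i, .y j => if (i : ℕ) + 1 = j ∨ (j : ℕ) + 1 = i then 4 else 2
  | .x i, .y j => if i = j then 3 else 2
  | .y i, .x j => if i = j then 3 else 2

open scoped Classical in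
/-- The face labels of `A_{2,n}`. -/
noncomputable def faceLabel {n : ℕ} (a b c : XY n) : ℕ :=
  if ∃ i j : Fin n, (i : ℕ) + 1 = j ∧
      (({a, b, c} : Set (XY n)) = {.x i, .x j, .y i} ∨
       ({a, b, c} : Set (XY n)) = {.x i, .x j, .y j} ∨
       ({a, b, c} : Set (XY n)) = {.x i, .y i, .y j} ∨
       ({a, b, c} : Set (XY n)) = {.x j, .y i, .y j}) then 3
  else if ∃ i j k : Fin n, (i : ℕ) + 1 = j ∧ (j : ℕ) + 1 = k ∧
      (({a, b, c} : Set (XY n)) = {.x i, .x j, .x k} ∨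
       ({a, b, c} : Set (XY n)) = {.y i, .y j, .y k}) then 4
  else 0

/-- The two-dimensional Coxeter system `A_{2,n}`. -/
noncomputable def coxeterA2 (n : ℕ) : TwoDimCoxeterSystem (XY n) where
  f := edgeLabel
  g := faceLabel
  f_symm a b := by
    cases a <;> cases b <;> simp only [edgeLabel, or_comm, eq_comm]
  g_swap_left a b c := by
    unfold faceLabel
    rw [Set.insert_comm a b {c}]
  g_swap_right a b c := by
    unfold faceLabel
    rw [Set.pair_comm b c]

/-- `GL_m(𝔽₂)`. -/
abbrev GLF2 (m : ℕ) : Type := Matrix.GeneralLinearGroup (Fin m) (ZMod 2)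

/-- The standard parabolic subgroup `P_λ` of `GL_m(𝔽₂)`: the invertible matrices that are block
upper triangular for the blocks of sizes `λ_1, …, λ_l`. -/
def standardParabolic {m : ℕ} (lam : Composition m) : Subgroup (GLF2 m) where
  carrier := {g | (g : Matrix (Fin m) (Fin m) (ZMod 2)).BlockTriangular lam.index}
  one_mem' := Matrix.blockTriangular_one
  mul_mem' ha hb := Matrix.BlockTriangular.mul ha hb
  inv_mem' {g} hg := by
    have : Invertible (g : Matrix (Fin m) (Fin m) (ZMod 2)) := g.invertible
    have h := Matrix.blockTriangular_inv_of_blockTriangular hg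
    simpa only [Set.mem_ofPred_eq, Matrix.coe_units_inv] using h

/-- The subgroup `H^t` of the transposes of the elements of `H`. -/
def transposeSubgroup {m : ℕ} (H : Subgroup (GLF2 m)) : Subgroup (GLF2 m) where
  carrier := {g | ∃ h ∈ H, (g : Matrix (Fin m) (Fin m) (ZMod 2)) =
    (h : Matrix (Fin m) (Fin m) (ZMod 2)).transpose}
  one_mem' := ⟨1, H.one_mem, by simp⟩
  mul_mem' := by
    rintro a b ⟨h, hh, ha⟩ ⟨k, hk, hb⟩
    exact ⟨k * h, H.mul_mem hk hh, by simp [ha, hb, Matrix.transpose_mul]⟩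
  inv_mem' := by
    rintro a ⟨h, hh, ha⟩
    refine ⟨h⁻¹, H.inv_mem hh, ?_⟩
    rw [Matrix.coe_units_inv, Matrix.coe_units_inv, ha, Matrix.transpose_nonsing_inv]

/-- `P_{λ|μ} = P_λ ∩ P_μ^t`. -/
def parabolicInter {m : ℕ} (lam mu : Composition m) : Subgroup (GLF2 m) :=
  standardParabolic lam ⊓ transposeSubgroup (standardParabolic mu)

/-- The stopovers `λ_1, λ_1 + λ_2, …, λ_1 + ⋯ + λ_{l-1}` of a composition. -/
def stopovers {m : ℕ} (lam : Composition m) : Set ℕ :=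
  {s | ∃ i, 1 ≤ i ∧ i < lam.length ∧ s = lam.sizeUpTo i}

/-- `S_{λ|μ}`: all `x_i` with `i` not a stopover of `λ` and all `y_j` with `j` not a stopover
of `μ`. -/
def stopoverFree {n : ℕ} (lam mu : Composition (n + 1)) : Set (XY n) :=
  {a | ∃ i : Fin n, (i : ℕ) + 1 ∉ stopovers lam ∧ a = .x i} ∪
  {a | ∃ j : Fin n, (j : ℕ) + 1 ∉ stopovers mu ∧ a = .y j}

/-- The elementary matrices `x_i ↦ I + E_{i+1,i}` and `y_i ↦ I + E_{i,i+1}`. -/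
def elementaryMatrix {n : ℕ} : XY n → Matrix (Fin (n + 1)) (Fin (n + 1)) (ZMod 2)
  | .x i => 1 + Matrix.single i.succ i.castSucc 1
  | .y i => 1 + Matrix.single i.castSucc i.succ 1

/-- The group of upper unitriangular matrices over `𝔽₂`. -/
def upperUnitriangular (m : ℕ) : Subgroup (GLF2 m) where
  carrier := {g | (∀ i j : Fin m, j < i → g i j = 0) ∧ ∀ i : Fin m, g i i = 1}
  one_mem' := by
    refine ⟨fun i j h => ?_, fun i => ?_⟩
    · simp [Matrix.one_apply_ne h.ne']
    · simp
  mul_mem' := by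
    rintro a b ⟨ha, ha'⟩ ⟨hb, hb'⟩
    have key : ∀ i, ∀ c : Fin m, c ≠ i → a i c * b c i = 0 := fun i c hc => by
      rcases lt_or_gt_of_ne hc with h | h
      · rw [ha i c h, zero_mul]
      · rw [hb c i h, mul_zero]
    refine ⟨fun i j h => ?_, fun i => ?_⟩
    · exact Matrix.BlockTriangular.mul (b := id) (M := a.1) (N := b.1)
        (fun i j h => ha i j h) (fun i j h => hb i j h) h
    · have : (a.1 * b.1) i i = 1 := by
        rw [Matrix.mul_apply, Finset.sum_eq_single i (fun c _ hc => key i c hc) (by simp)]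
        exact (congrArg₂ (· * ·) (ha' i) (hb' i)).trans (one_mul 1)
      exact this
  inv_mem' := by
    rintro a ⟨ha, ha'⟩
    have : Invertible a.1 := a.invertible
    have hT : Matrix.BlockTriangular (a⁻¹).1 id := by
      have h := Matrix.blockTriangular_inv_of_blockTriangular (b := id) (M := a.1)
        (fun i j h => ha i j h)
      simpa only [Matrix.coe_units_inv] using h
    refine ⟨fun i j h => hT h, fun i => ?_⟩
    have h1 : (a.1 * (a⁻¹).1) i i = 1 := by
      rw [Units.mul_inv]
      simp
    rw [Matrix.mul_apply, Finset.sum_eq_single i (fun c _ hc => ?_) (by simp)] at h1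
    · have h2 : a.1 i i = 1 := ha' i
      rw [h2, one_mul] at h1
      exact h1
    · rcases lt_or_gt_of_ne hc with h | h
      · exact mul_eq_zero_of_left (ha i c h) _
      · exact mul_eq_zero_of_right _ (hT h)

/-! The Coxeter relations turn out to be a short presentation of a group defined by Steinberg
relations, and that group is identified with a matrix group by making it act on column vectors.

Write `t i j` for the element destined to become `1 + E_{i,j}`: an iterated commutator of
consecutive `y`'s when `i < j`, of consecutive `x`'s when `j < i`. Let `R i j` mean that every
generator on the way from `i` to `j` is present; this is a preorder on the matrix positions. The
exponents are translated as follows. For involutions, `(a b)^4 = 1` makes `[a, b]` an involution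
commuting with `a` and `b`; a triple label 4 says that two overlapping commutators commute; a triple
label 3 says `[z, [a, b]] = b`, the action of a generator on an opposite root of length two. From
these local relations all Steinberg relations for pairs in `R` follow: those among the `y`'s, and
among the `x`'s, by induction on the length of a window of consecutive generators
(`WindowRelations.succ`), the mixed ones by induction on the length of the upper root
(`MixedRelations.oppositeRelations`), and the braid relation for opposite roots by conjugation with
Weyl elements (`braid_rootElement`).

Conversely, elementary matrices satisfy the Coxeter relations, so there is a homomorphism to `GL`
over `𝔽₂`. It is injective because any representation sending each `t i j` to `1 + E_{i,j}` is
faithful (`eq_one_of_rep_eq_one`): a coset decomposition shows that an element fixing the basis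
vector `e_p` already lies in the subgroup generated by the `t i j` with `j ≠ p`; splitting off the
row of `p` then leaves a smaller index set. Its image is the group of all invertible matrices
supported on `R`, since Gaussian elimination can be carried out inside that group
(`eq_rootSubgroup_elementaryGL`). For `P_{λ|μ}` the support condition is that no stopover blocks the
path from `i` to `j`, which is exactly `R`.

Locality comes from the order `x_1, y_1, x_2, y_2, …`, in which non-commuting generators are at most
two places apart. -/

open scoped commutatorElement

/-! ### Commutator calculus for involutions. -/

section Commutators

variable {G : Type*} [Group G]

theorem Commute.commutatorElement_right {z p q : G} (hp : Commute z p) (hq : Commute z q) :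
    Commute z ⁅p, q⁆ :=
  ((hp.mul_right hq).mul_right hp.inv_right).mul_right hq.inv_right

theorem inv_eq_self_of_mul_self {a : G} (h : a * a = 1) : a⁻¹ = a := inv_eq_of_mul_eq_one_left h

theorem commutatorElement_of_mul_self {a b : G} (ha : a * a = 1) (hb : b * b = 1) :
    ⁅a, b⁆ = a * b * a * b := by
  rw [commutatorElement_def, inv_eq_self_of_mul_self ha, inv_eq_self_of_mul_self hb]

/-- If the commutator of `a` and `b` is an involution, then it is symmetric in `a` and `b`. -/
theorem commutatorElement_symm_of_mul_self {a b c : G} (h : ⁅a, b⁆ = c) (hc : c * c = 1) :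
    ⁅b, a⁆ = c := by
  rw [← commutatorElement_inv, h, inv_eq_self_of_mul_self hc]

/-- Conjugation by the involution `a` turns `a b a b` into `b a b a`, its inverse; if it also fixes
the commutator, the commutator is its own inverse. -/
theorem commutatorElement_mul_self {a b : G} (ha : a * a = 1) (hb : b * b = 1)
    (h : Commute ⁅a, b⁆ a) : ⁅a, b⁆ * ⁅a, b⁆ = 1 := by
  have ha' := inv_eq_self_of_mul_self ha
  have hb' := inv_eq_self_of_mul_self hb
  have h1 : a * ⁅a, b⁆ * a⁻¹ = ⁅a, b⁆⁻¹ := by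
    rw [commutatorElement_inv, commutatorElement_def, commutatorElement_def, ha', hb',
      ← mul_assoc, ← mul_assoc, ← mul_assoc, ha, one_mul]
  rw [← h.eq, mul_inv_cancel_right] at h1
  nth_rewrite 1 [h1]
  exact inv_mul_cancel _

theorem pow_four_eq_one_iff_mul_self {a b : G} (ha : a * a = 1) (hb : b * b = 1) :
    (a * b) ^ 4 = 1 ↔ ⁅a, b⁆ * ⁅a, b⁆ = 1 := by
  rw [commutatorElement_of_mul_self ha hb]
  simp only [pow_succ, pow_zero, one_mul, mul_assoc]

theorem commute_commutatorElement_of_pow_four {a b : G} (ha : a * a = 1) (hb : b * b = 1)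
    (h : (a * b) ^ 4 = 1) : Commute ⁅a, b⁆ a ∧ Commute ⁅a, b⁆ b := by
  have ha' := inv_eq_self_of_mul_self ha
  have hb' := inv_eq_self_of_mul_self hb
  have h1 := inv_eq_self_of_mul_self ((pow_four_eq_one_iff_mul_self ha hb).1 h)
  have hba : ⁅b, a⁆ = ⁅a, b⁆ := by rw [← commutatorElement_inv, h1]
  constructor
  · change _ = _
    nth_rewrite 2 [← hba]
    rw [commutatorElement_of_mul_self ha hb, commutatorElement_of_mul_self hb ha]
    simp only [mul_assoc]
  · change _ = _
    nth_rewrite 1 [← hba]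
    rw [commutatorElement_of_mul_self ha hb, commutatorElement_of_mul_self hb ha]
    simp only [mul_assoc]

/-- For involutions with `a`, `c` commuting, `(a b c) ^ 4 = 1` says that `[a, b]` and `[b, c]`
commute. -/
theorem triple_pow_four_iff {a b c : G} (ha : a * a = 1) (hb : b * b = 1) (hc : c * c = 1)
    (hac : Commute a c) (hab : ⁅a, b⁆ * ⁅a, b⁆ = 1) (hbc : ⁅b, c⁆ * ⁅b, c⁆ = 1) :
    (a * b * c) ^ 4 = 1 ↔ Commute ⁅a, b⁆ ⁅b, c⁆ := by
  -- The fourth power is the square of a product of two involutions, which is trivial exactly when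
  -- these commute.
  have h2 : (a * b * c) ^ 2 = ⁅a, b⁆ * ⁅b, c⁆ := by
    rw [commutatorElement_of_mul_self ha hb, commutatorElement_of_mul_self hb hc, pow_two]
    calc a * b * c * (a * b * c) = a * b * (c * a) * b * c := by simp only [mul_assoc]
      _ = a * b * a * (c * b * c) := by rw [← hac.eq]; simp only [mul_assoc]
      _ = a * b * a * (b * b) * (c * b * c) := by rw [hb, mul_one]
      _ = _ := by simp only [mul_assoc]
  have hu := inv_eq_self_of_mul_self hab
  have hv := inv_eq_self_of_mul_self hbc
  rw [show 4 = 2 * 2 from rfl, pow_mul, h2, pow_two, mul_eq_one_iff_eq_inv, mul_inv_rev, hu, hv]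
  rfl

/-- The instance of the Hall-Witt identity that makes iterated commutators associative. -/
theorem commutatorElement_assoc {a b c : G} (hac : Commute a c) (h1 : Commute ⁅a, b⁆ ⁅b, c⁆)
    (h3 : Commute ⁅b, c⁆ c) :
    ⁅a, ⁅b, c⁆⁆ = ⁅⁅a, b⁆, c⁆ := by
  have e1 : a * b * a⁻¹ = ⁅a, b⁆ * b := by rw [commutatorElement_def]; group
  have e2 : a * c * a⁻¹ = c := by rw [hac.eq, mul_inv_cancel_right]
  have e3 : b * c * b⁻¹ = ⁅b, c⁆ * c := by rw [commutatorElement_def]; group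
  -- The conjugate of `[b, c]` by `a` is computed in a second way: `a` fixes `c` and sends `b` to
  -- `[a, b] b`.
  have e4 : a * ⁅b, c⁆ * a⁻¹ = ⁅⁅a, b⁆ * b, c⁆ := by
    rw [← e1]
    nth_rewrite 2 [← e2]
    simp only [commutatorElement_def]
    group
  have e5 : ⁅⁅a, b⁆ * b, c⁆ = ⁅⁅a, b⁆, c⁆ * ⁅b, c⁆ := by
    have : ⁅⁅a, b⁆ * b, c⁆ = ⁅a, b⁆ * ⁅b, c⁆ * c * ⁅a, b⁆⁻¹ * c⁻¹ := by
      simp only [commutatorElement_def]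
      group
    rw [this, h1.eq]
    have h4 : Commute ⁅b, c⁆ ⁅⁅a, b⁆, c⁆ := h1.symm.commutatorElement_right h3
    rw [← h4.eq]
    simp only [commutatorElement_def]
    group
  have e6 : ⁅a, ⁅b, c⁆⁆ = a * ⁅b, c⁆ * a⁻¹ * ⁅b, c⁆⁻¹ := commutatorElement_def _ _
  rw [e6, e4, e5, mul_inv_cancel_right]

/-- If `p` moves `z` only by something that commutes with `q`, then `[p, q]` commutes with `z`. -/
theorem commute_commutatorElement_of_conj {p q z c : G} (hp : p * p = 1) (hqz : Commute q z)
    (hpz : ⁅p, z⁆ = c) (hqc : Commute q c) : Commute ⁅p, q⁆ z := by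
  have h1 : p * z * p⁻¹ = c * z := by rw [← hpz, commutatorElement_def]; group
  have h2 : Commute q (p * z * p⁻¹) := h1 ▸ hqc.mul_right hqz
  have h3 : Commute (p⁻¹ * q * p) z := by
    change _ = _
    calc p⁻¹ * q * p * z = p⁻¹ * (q * (p * z * p⁻¹)) * p := by group
      _ = _ := by rw [h2.eq]; group
  rw [inv_eq_self_of_mul_self hp] at h3
  rw [commutatorElement_def, inv_eq_self_of_mul_self hp]
  exact h3.mul_left hqz.inv_left

/-- Conjugation by `z` fixes `q` and sends `p` to `c p`, and `[c p, q] = c [p, q] c⁻¹ [c, q]`. This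
carries a known bracket with a short root `p` over to the longer root `[p, q]`. -/
theorem commutatorElement_commutatorElement_right {z p q c n : G} (hzp : ⁅z, p⁆ = c)
    (hzq : Commute z q) (hcn : ⁅c, q⁆ = n) (hc : Commute c ⁅p, q⁆) (hn : Commute n ⁅p, q⁆) :
    ⁅z, ⁅p, q⁆⁆ = n := by
  have h1 : z * p * z⁻¹ = c * p := by rw [← hzp, commutatorElement_def]; group
  have h2 : z * q * z⁻¹ = q := by rw [hzq.eq, mul_inv_cancel_right]
  have h3 : z * ⁅p, q⁆ * z⁻¹ = ⁅c * p, q⁆ := by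
    rw [← h1]
    nth_rewrite 2 [← h2]
    simp only [commutatorElement_def]
    group
  have h4 : ⁅c * p, q⁆ = c * ⁅p, q⁆ * c⁻¹ * ⁅c, q⁆ := by
    simp only [commutatorElement_def]
    group
  rw [commutatorElement_def, h3, h4, hc.eq, mul_inv_cancel_right, hcn, ← hn.eq,
    mul_inv_cancel_right]

/-- Conjugation by `z` fixes `a` and sends `b` to `c b`; as `c` commutes with `a` and `b`, the
commutator `[a, c b]` is `c [a, b] c⁻¹ = [a, b]`. -/
theorem commute_commutatorElement_of_conj_right {z a b c : G} (hza : Commute z a)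
    (hzb : ⁅z, b⁆ = c) (hca : Commute c a) (hcb : Commute c b) : Commute z ⁅a, b⁆ := by
  have h1 : z * a * z⁻¹ = a := by rw [hza.eq, mul_inv_cancel_right]
  have h2 : z * b * z⁻¹ = c * b := by rw [← hzb, commutatorElement_def]; group
  have h3 : z * ⁅a, b⁆ * z⁻¹ = ⁅a, c * b⁆ := by
    rw [← h2]
    nth_rewrite 2 [← h1]
    simp only [commutatorElement_def]
    group
  have h4 : ⁅a, c * b⁆ = c * ⁅a, b⁆ * c⁻¹ := by
    have : ⁅a, c * b⁆ = (a * c) * b * a⁻¹ * b⁻¹ * c⁻¹ := by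
      simp only [commutatorElement_def]
      group
    rw [this, ← hca.eq]
    simp only [commutatorElement_def]
    group
  rw [h4, (hca.commutatorElement_right hcb).eq, mul_inv_cancel_right] at h3
  change _ = _
  rw [← mul_inv_eq_iff_eq_mul, h3]

end Commutators

/-! ### Root elements and the Steinberg relations of the unitriangular group. -/

section RootElements

variable {G : Type*} [Group G]

/-- The iterated commutator `[… [[y i, y (i + 1)], y (i + 2)], …, y (j - 1)]`. -/
def rootElement (y : ℕ → G) (i : ℕ) : ℕ → G
  -- For `j ≤ i` the value is `1`, since the recursion only forms commutators with `1` until it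
  -- reaches `i + 1`.
  | 0 => 1
  | j + 1 => if i = j then y i else ⁅rootElement y i j, y j⁆

variable {y : ℕ → G}

theorem rootElement_succ_self (i : ℕ) : rootElement y i (i + 1) = y i := by simp [rootElement]

theorem rootElement_succ {i j : ℕ} (h : i < j) :
    rootElement y i (j + 1) = ⁅rootElement y i j, y j⁆ := by
  simp [rootElement, h.ne]

theorem Commute.rootElement_right {g : G} {i j : ℕ} (hij : i < j)
    (h : ∀ k, i ≤ k → k < j → Commute g (y k)) : Commute g (rootElement y i j) := by
  induction j, hij using Nat.le_induction with
  | base => rw [rootElement_succ_self]; exact h i le_rfl (Nat.lt_succ_self i)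
  | succ j hj ih =>
    rw [rootElement_succ hj]
    exact (ih fun k h1 h2 => h k h1 (h2.trans (Nat.lt_succ_self j))).commutatorElement_right
      (h j (Nat.le_of_succ_le hj) (Nat.lt_succ_self j))

/-- The relations of the generators `y i = 1 + E_{i,i+1}` of the upper unitriangular group. -/
structure UnitriangularRelations (y : ℕ → G) : Prop where
  mul_self : ∀ i, y i * y i = 1
  comm : ∀ i j, i + 1 < j → Commute (y i) (y j)
  pair : ∀ i, (y i * y (i + 1)) ^ 4 = 1
  triple : ∀ i, (y i * y (i + 1) * y (i + 2)) ^ 4 = 1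

/-- The Steinberg relations of the root elements inside all windows of `m` consecutive
generators. -/
structure WindowRelations (y : ℕ → G) (m : ℕ) : Prop where
  mul_self : ∀ a b, a < b → b ≤ a + m → rootElement y a b * rootElement y a b = 1
  bracket : ∀ a b c, a < b → b < c → c ≤ a + m →
    ⁅rootElement y a b, rootElement y b c⁆ = rootElement y a c
  comm : ∀ l a b c d, a < b → c < d → l ≤ a → l ≤ c → b ≤ l + m → d ≤ l + m → b ≠ c → a ≠ d →
    Commute (rootElement y a b) (rootElement y c d)

theorem rootElement_commute_rootElement_of_lt {a b c d : ℕ}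
    (hy : ∀ i j, i + 1 < j → Commute (y i) (y j)) (hab : a < b) (hbc : b < c) (hcd : c < d) :
    Commute (rootElement y a b) (rootElement y c d) :=
  Commute.rootElement_right hcd fun k hk _ =>
    (Commute.rootElement_right hab fun l _ hl => (hy l k (by omega)).symm).symm

namespace WindowRelations

variable {m : ℕ}

theorem one (h : ∀ i, y i * y i = 1) : WindowRelations y 1 := by
  refine ⟨fun a b h1 h2 => ?_, by omega, fun l a b c d h1 h2 h3 h4 h5 h6 _ _ => ?_⟩
  · obtain rfl : b = a + 1 := by omega
    rw [rootElement_succ_self, h]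
  · obtain rfl : a = c := by omega
    obtain rfl : b = d := by omega
    exact Commute.refl _

variable (hw : WindowRelations y m) (h : UnitriangularRelations y)

include hw h

/-- Inside a window with at least three generators, a root element starting at the left end and one
ending at the right end commute. -/
theorem comm_ends (hm : 1 ≤ m) {a k l : ℕ} (h1 : a < k) (h2 : k < a + m + 1) (h3 : a < l)
    (h4 : l < a + m + 1) (hkl : k ≠ l) :
    Commute (rootElement y a k) (rootElement y l (a + m + 1)) := by
  rcases lt_or_gt_of_ne hkl with hlt | hlt
  · exact rootElement_commute_rootElement_of_lt h.comm h1 hlt h4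
  -- The overlapping case `l < k` is reduced to `k = l + 1`: cutting the left root at `z` leaves a
  -- second factor that lies with the other root in the window starting at `a + 1`.
  have step : ∀ z, l < z → z < k → Commute (rootElement y a z) (rootElement y l (a + m + 1)) →
      Commute (rootElement y a k) (rootElement y l (a + m + 1)) := fun z z1 z2 hz => by
    rw [← hw.bracket a z k (by omega) z2 (by omega)]
    exact (hz.symm.commutatorElement_right
      (hw.comm (a + 1) l (a + m + 1) z k h4 z2 (by omega) (by omega) (by omega) (by omega)
        (by omega) (by omega))).symm
  have next : Commute (rootElement y a (l + 1)) (rootElement y l (a + m + 1)) := by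
    rcases Nat.lt_or_ge (a + 1) l with hz | hz
    · rw [← hw.bracket a (a + 1) (l + 1) (by omega) (by omega) (by omega)]
      exact ((rootElement_commute_rootElement_of_lt h.comm (Nat.lt_succ_self a) hz
        h4).symm.commutatorElement_right
        (hw.comm (a + 1) l (a + m + 1) (a + 1) (l + 1) h4 (by omega) (by omega) (by omega)
          (by omega) (by omega) (by omega) (by omega))).symm
    · obtain rfl : l = a + 1 := by omega
      -- With four or more generators the right root is cut before its last letter: one factor
      -- shares a smaller window with the left root, the other is disjoint from it.
      rcases Nat.lt_or_ge (a + 2) (a + m) with hz' | hz'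
      · rw [← hw.bracket (a + 1) (a + m) (a + m + 1) (by omega) (by omega) (by omega)]
        exact (hw.comm a a (a + 1 + 1) (a + 1) (a + m) (by omega) (by omega) (by omega) (by omega)
          (by omega) (by omega) (by omega) (by omega)).commutatorElement_right
          (rootElement_commute_rootElement_of_lt h.comm (by omega) (by omega) (by omega))
      -- Three generators are the base case, and the only place where the triple relation of
      -- exponent 4 enters.
      · obtain rfl : m = 2 := by omega
        rw [rootElement_succ (by omega), rootElement_succ_self,
          show a + 2 + 1 = a + 1 + 1 + 1 from rfl, rootElement_succ (by omega),
          rootElement_succ_self]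
        refine (triple_pow_four_iff (h.mul_self _) (h.mul_self _) (h.mul_self _)
          (h.comm a (a + 1 + 1) (by omega)) ?_ ?_).1 (h.triple a)
        · exact (pow_four_eq_one_iff_mul_self (h.mul_self _) (h.mul_self _)).1 (h.pair a)
        · exact (pow_four_eq_one_iff_mul_self (h.mul_self _) (h.mul_self _)).1 (h.pair (a + 1))
  rcases Nat.lt_or_ge (l + 1) k with hk | hk
  · exact step (l + 1) (by omega) hk next
  · obtain rfl : k = l + 1 := by omega
    exact next

/-- The long root is defined by cutting off its last letter. Associativity of iterated commutators
moves the cut from `k + 1` to `k`, so by descending induction the place of the cut is immaterial. -/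
theorem bracket_ends (hm : 1 ≤ m) {a k : ℕ} (h1 : a < k) (h2 : k < a + m + 1) :
    ⁅rootElement y a k, rootElement y k (a + m + 1)⁆ = rootElement y a (a + m + 1) := by
  obtain ⟨j, hj⟩ : ∃ j, j + k = a + m := ⟨a + m - k, by omega⟩
  induction j generalizing k with
  | zero =>
    obtain rfl : k = a + m := by omega
    rw [rootElement_succ_self, ← rootElement_succ h1]
  | succ j ih =>
    rw [← ih (k := k + 1) (by omega) (by omega) (by omega),
      ← hw.bracket k (k + 1) (a + m + 1) (by omega) (by omega) (by omega),
      ← hw.bracket a k (k + 1) (by omega) (by omega) (by omega)]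
    apply commutatorElement_assoc
    · exact hw.comm_ends h hm h1 h2 (by omega) (by omega) (by omega)
    · rw [hw.bracket k (k + 1) (a + m + 1) (by omega) (by omega) (by omega),
        hw.bracket a k (k + 1) (by omega) (by omega) (by omega)]
      exact hw.comm_ends h hm (by omega) (by omega) (by omega) (by omega) (by omega)
    · rw [hw.bracket k (k + 1) (a + m + 1) (by omega) (by omega) (by omega)]
      exact hw.comm (a + 1) k (a + m + 1) (k + 1) (a + m + 1) (by omega) (by omega) (by omega)
        (by omega) (by omega) (by omega) (by omega) (by omega)

/-- Since the long root may be cut anywhere, a cut convenient for `y j` is chosen. At either end of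
the window, cutting at the opposite end gives two factors commuting with `y j`. In the interior the
cut is at `j + 1`: the left factor commutes with `y j`, and the right one is moved only by an
element commuting with both factors. -/
theorem comm_long (hm : 1 ≤ m) {a j : ℕ} (h1 : a ≤ j) (h2 : j < a + m + 1) :
    Commute (y j) (rootElement y a (a + m + 1)) := by
  rcases Nat.lt_or_ge m 2 with hm2 | hm2
  · obtain rfl : m = 1 := by omega
    rw [rootElement_succ (by omega), rootElement_succ_self]
    have := commute_commutatorElement_of_pow_four (h.mul_self _) (h.mul_self _) (h.pair a)
    obtain rfl | rfl : j = a ∨ j = a + 1 := by omega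
    · exact this.1.symm
    · exact this.2.symm
  rw [← rootElement_succ_self (y := y) j]
  rcases eq_or_ne j a with rfl | hja
  · rw [← hw.bracket_ends h hm (k := j + m) (by omega) (by omega)]
    exact (hw.comm j j (j + 1) j (j + m) (by omega) (by omega) (by omega) (by omega) (by omega)
      (by omega) (by omega) (by omega)).commutatorElement_right
      (hw.comm_ends h hm (by omega) (by omega) (by omega) (by omega) (by omega))
  rcases eq_or_ne j (a + m) with rfl | hjm
  · rw [← hw.bracket_ends h hm (k := a + 1) (by omega) (by omega)]
    exact (hw.comm_ends h hm (by omega) (by omega) (by omega) (by omega)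
      (by omega)).symm.commutatorElement_right
      (hw.comm (a + 1) (a + m) (a + m + 1) (a + 1) (a + m + 1) (by omega) (by omega) (by omega)
      (by omega) (by omega) (by omega) (by omega) (by omega))
  · rw [← hw.bracket_ends h hm (k := j + 1) (by omega) (by omega)]
    refine commute_commutatorElement_of_conj_right (c := rootElement y j (a + m + 1))
      ?_ (hw.bracket _ _ _ (by omega) (by omega) (by omega)) ?_ ?_
    · exact hw.comm a j (j + 1) a (j + 1) (by omega) (by omega) (by omega) (by omega) (by omega)
        (by omega) (by omega) (by omega)
    · exact (hw.comm_ends h hm (by omega) (by omega) (by omega) (by omega) (by omega)).symm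
    · exact hw.comm (a + 1) j (a + m + 1) (j + 1) (a + m + 1) (by omega) (by omega) (by omega)
        (by omega) (by omega) (by omega) (by omega) (by omega)

theorem succ (hm : 1 ≤ m) : WindowRelations y (m + 1) := by
  have long : ∀ a c d, c < d → a ≤ c → d ≤ a + m + 1 →
      Commute (rootElement y c d) (rootElement y a (a + m + 1)) := fun a c d h1 h2 h3 =>
    (Commute.rootElement_right h1 fun k h4 h5 =>
      (hw.comm_long h hm (by omega) (by omega)).symm).symm
  refine ⟨fun a b h1 h2 => ?_, fun a b c h1 h2 h3 => ?_,
    fun l a b c d h1 h2 h3 h4 h5 h6 h7 h8 => ?_⟩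
  · rcases Nat.lt_or_ge b (a + m + 1) with hb | hb
    · exact hw.mul_self a b h1 (by omega)
    · obtain rfl : b = a + m + 1 := by omega
      rw [← hw.bracket_ends h hm (k := a + 1) (by omega) (by omega)]
      refine commutatorElement_mul_self (hw.mul_self _ _ (by omega) (by omega))
        (hw.mul_self _ _ (by omega) (by omega)) ?_
      rw [hw.bracket_ends h hm (k := a + 1) (by omega) (by omega)]
      exact (long a a (a + 1) (by omega) (by omega) (by omega)).symm
  · rcases Nat.lt_or_ge c (a + m + 1) with hb | hb
    · exact hw.bracket a b c h1 h2 (by omega)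
    · obtain rfl : c = a + m + 1 := by omega
      exact hw.bracket_ends h hm h1 h2
  -- Only pairs that together reach both ends of the enlarged window are new: either one root is the
  -- whole window, or one starts at the left end and the other stops at the right end.
  · rcases Nat.lt_or_ge (max b d) (l + m + 1) with hb | hb
    · exact hw.comm l a b c d h1 h2 h3 h4 (by omega) (by omega) h7 h8
    rcases Nat.lt_or_ge l (min a c) with ha | ha
    · exact hw.comm (l + 1) a b c d h1 h2 (by omega) (by omega) (by omega) (by omega) h7 h8
    by_cases e1 : a = l ∧ b = l + m + 1
    · obtain ⟨rfl, rfl⟩ := e1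
      exact (long _ c d h2 h4 h6).symm
    by_cases e2 : c = l ∧ d = l + m + 1
    · obtain ⟨rfl, rfl⟩ := e2
      exact long _ a b h1 h3 h5
    by_cases e3 : a = l
    · subst e3
      obtain rfl : d = a + m + 1 := by omega
      exact hw.comm_ends h hm h1 (by omega) (by omega) h2 h7
    · obtain rfl : c = l := by omega
      obtain rfl : b = c + m + 1 := by omega
      exact (hw.comm_ends h hm h2 (by omega) (by omega) h1 (by omega)).symm

end WindowRelations

namespace UnitriangularRelations

variable (h : UnitriangularRelations y)

include h

theorem window (m : ℕ) : WindowRelations y (m + 1) := by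
  induction m with
  | zero => exact WindowRelations.one h.mul_self
  | succ m ih => exact ih.succ h (by omega)

theorem rootElement_mul_self {a b : ℕ} (hab : a < b) :
    rootElement y a b * rootElement y a b = 1 :=
  (h.window b).mul_self a b hab (by omega)

theorem rootElement_bracket {a b c : ℕ} (hab : a < b) (hbc : b < c) :
    ⁅rootElement y a b, rootElement y b c⁆ = rootElement y a c :=
  (h.window c).bracket a b c hab hbc (by omega)

theorem rootElement_comm {a b c d : ℕ} (hab : a < b) (hcd : c < d) (hbc : b ≠ c) (had : a ≠ d) :
    Commute (rootElement y a b) (rootElement y c d) :=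
  (h.window (b + d)).comm 0 a b c d hab hcd (by omega) (by omega) (by omega) (by omega) hbc had

end UnitriangularRelations

end RootElements

/-! ### Order-three relations and Weyl elements. -/

section Triples

variable {G : Type*} [Group G]

theorem mul_pow_eq_one_comm {a b : G} {n : ℕ} (h : (a * b) ^ n = 1) : (b * a) ^ n = 1 := by
  have : b * a = b * (a * b) * b⁻¹ := by group
  rw [this, conj_pow, h, mul_one, mul_inv_cancel]

theorem braid_iff {a b : G} (ha : a * a = 1) (hb : b * b = 1) :
    (a * b) ^ 3 = 1 ↔ a * b * a = b * a * b := by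
  have : (a * b) ^ 3 = a * b * a * (b * a * b) := by
    simp only [pow_succ, pow_zero, one_mul, mul_assoc]
  rw [this, mul_eq_one_iff_eq_inv, mul_inv_rev, mul_inv_rev, inv_eq_self_of_mul_self ha,
    inv_eq_self_of_mul_self hb, mul_assoc b a b]

/-- The model is `a = 1 + E_{i,j}`, `b = 1 + E_{j,k}`, `z = 1 + E_{j,i}`. The braid relation of `a`
and `z` rewrites `(z a b)^3` as `a (z a b a z) (b a b)`, so the cube is trivial exactly when `z a b
a z = [a, b]`. As `z` commutes with `b`, this reads `z [a, b] z⁻¹ = [a, b] b`. -/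
theorem triple_pow_three_iff {a b z : G} (ha : a * a = 1) (hb : b * b = 1) (hz : z * z = 1)
    (hzb : Commute z b) (haz : (a * z) ^ 3 = 1) (hab : Commute ⁅a, b⁆ b) :
    (a * b * z) ^ 3 = 1 ↔ ⁅z, ⁅a, b⁆⁆ = b := by
  have hbr := (braid_iff ha hz).1 haz
  have e1 : (z * (a * b)) ^ 3 = a * (z * a * b * a * z) * (b * a * b) := by
    calc (z * (a * b)) ^ 3 = z * a * (b * z) * a * (b * z) * a * b := by
          simp only [pow_succ, pow_zero, one_mul, mul_assoc]
      _ = (z * a * z) * b * a * z * b * a * b := by rw [← hzb.eq]; simp only [mul_assoc]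
      _ = _ := by rw [← hbr]; simp only [mul_assoc]
  have e2 : (z * (a * b)) ^ 3 = 1 ↔ z * a * b * a * z = ⁅a, b⁆ := by
    rw [e1, mul_eq_one_iff_eq_inv, ← eq_inv_mul_iff_mul_eq, mul_inv_rev, mul_inv_rev,
      commutatorElement_of_mul_self ha hb, inv_eq_self_of_mul_self ha, inv_eq_self_of_mul_self hb]
    simp only [mul_assoc]
  have e3 : z * ⁅a, b⁆ * z⁻¹ = z * a * b * a * z * b := by
    rw [commutatorElement_of_mul_self ha hb, inv_eq_self_of_mul_self hz]
    calc z * (a * b * a * b) * z = z * a * b * a * (b * z) := by simp only [mul_assoc]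
      _ = _ := by rw [← hzb.eq]; simp only [mul_assoc]
  rw [commutatorElement_def z, mul_inv_eq_iff_eq_mul, e3, ← hab.eq, mul_left_inj, ← e2]
  exact ⟨mul_pow_eq_one_comm, mul_pow_eq_one_comm⟩

/-- On the abelian group generated by `a` and `b` the elements `p` and `z` act as the two opposite
transvections, so `p z p` acts as the Weyl reflection: `a ↦ a b ↦ b ↦ b`. -/
theorem weyl_conj {p z a b : G} (h1 : ⁅p, a⁆ = b) (h2 : ⁅z, b⁆ = a) (h3 : Commute p b)
    (h4 : Commute z a) (h5 : Commute a b) (h6 : a * a = 1) :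
    (p * z * p) * a * (p * z * p)⁻¹ = b := by
  have e1 : p * a = b * a * p := by rw [← h1, commutatorElement_def]; group
  have e2 : z * b = a * b * z := by rw [← h2, commutatorElement_def]; group
  rw [mul_inv_eq_iff_eq_mul]
  calc p * z * p * a = p * z * (p * a) := by simp only [mul_assoc]
    _ = p * (z * b) * a * p := by rw [e1]; simp only [mul_assoc]
    _ = p * a * b * (z * a) * p := by rw [e2]; simp only [mul_assoc]
    _ = p * (a * b) * a * z * p := by rw [h4.eq]; simp only [mul_assoc]
    _ = p * b * (a * a) * z * p := by rw [h5.eq]; simp only [mul_assoc]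
    _ = _ := by rw [h6, h3.eq]; simp only [mul_assoc, one_mul]

end Triples

/-- The Steinberg relations over `𝔽₂` for elements `t i j` indexed by the pairs in a transitive
relation. -/
structure SteinbergRelations {ι G : Type*} [Group G] (R : ι → ι → Prop) (t : ι → ι → G) : Prop where
  trans : ∀ i j k, R i j → R j k → R i k
  mul_self : ∀ i j, t i j * t i j = 1
  comm : ∀ i j k l, i ≠ j → k ≠ l → R i j → R k l → j ≠ k → i ≠ l → Commute (t i j) (t k l)
  bracket : ∀ i j k, i ≠ j → j ≠ k → i ≠ k → R i j → R j k → ⁅t i j, t j k⁆ = t i k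
  braid : ∀ i j, i ≠ j → R i j → R j i → t i j * t j i * t i j = t j i * t i j * t j i

/-! ### Steinberg relations between lower and upper root elements. -/

section Mixed

variable {G : Type*} [Group G]

/-- The relations between the generators `x i = 1 + E_{i+1,i}` and `y i = 1 + E_{i,i+1}`, where the
generators outside `Sx` and `Sy` are missing. -/
structure MixedRelations (x y : ℕ → G) (Sx Sy : ℕ → Prop) : Prop where
  lower : UnitriangularRelations x
  upper : UnitriangularRelations y
  comm : ∀ i j, i ≠ j → Commute (x i) (y j)
  -- The relations above survive when a missing generator is replaced by `1`; those of order three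
  -- may not, so they ask for the presence of their letters.
  braid : ∀ i, Sx i → Sy i → (x i * y i) ^ 3 = 1
  xxy_left : ∀ i, Sx i → Sx (i + 1) → Sy i → (x i * x (i + 1) * y i) ^ 3 = 1
  xxy_right : ∀ i, Sx i → Sx (i + 1) → Sy (i + 1) → (x i * x (i + 1) * y (i + 1)) ^ 3 = 1
  xyy_left : ∀ i, Sx i → Sy i → Sy (i + 1) → (x i * y i * y (i + 1)) ^ 3 = 1
  xyy_right : ∀ i, Sx (i + 1) → Sy i → Sy (i + 1) → (x (i + 1) * y i * y (i + 1)) ^ 3 = 1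

/-- The relation `R i j`, under which all generators between `i` and `j` in the direction from `i`
to `j` are present. -/
def PathRel (Sx Sy : ℕ → Prop) (i j : ℕ) : Prop :=
  (∀ k, i ≤ k → k < j → Sy k) ∧ ∀ k, j ≤ k → k < i → Sx k

theorem PathRel.trans {Sx Sy : ℕ → Prop} {i j k : ℕ} (h1 : PathRel Sx Sy i j)
    (h2 : PathRel Sx Sy j k) : PathRel Sx Sy i k := by
  refine ⟨fun l h3 h4 => ?_, fun l h3 h4 => ?_⟩
  · rcases lt_or_ge l j with h | h
    · exact h1.1 l h3 h
    · exact h2.1 l h h4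
  · rcases lt_or_ge l j with h | h
    · exact h2.2 l h3 h
    · exact h1.2 l h h4

/-- The element of the group corresponding to `1 + E_{i,j}`. -/
def transvectionElement (x y : ℕ → G) (i j : ℕ) : G :=
  if i < j then rootElement y i j else if j < i then rootElement x j i else 1

variable {x y : ℕ → G} {Sx Sy : ℕ → Prop}

theorem transvectionElement_of_lt {i j : ℕ} (h : i < j) :
    transvectionElement x y i j = rootElement y i j := if_pos h

theorem transvectionElement_of_gt {i j : ℕ} (h : j < i) :
    transvectionElement x y i j = rootElement x j i := by
  rw [transvectionElement, if_neg h.not_gt, if_pos h]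

theorem UnitriangularRelations.rootElement_bracket_symm (h : UnitriangularRelations y) {a b c : ℕ}
    (hab : a < b) (hbc : b < c) : ⁅rootElement y b c, rootElement y a b⁆ = rootElement y a c :=
  commutatorElement_symm_of_mul_self (h.rootElement_bracket hab hbc)
    (h.rootElement_mul_self (hab.trans hbc))

theorem UnitriangularRelations.commute_pair (h : UnitriangularRelations y) (i : ℕ) :
    Commute ⁅y i, y (i + 1)⁆ (y i) ∧ Commute ⁅y i, y (i + 1)⁆ (y (i + 1)) :=
  commute_commutatorElement_of_pow_four (h.mul_self _) (h.mul_self _) (h.pair i)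

namespace MixedRelations

variable (h : MixedRelations x y Sx Sy)

include h

/-- This is the symmetry of transposition. It turns results on a `y` acting on lower roots into
results on an `x` acting on upper roots. -/
theorem swap : MixedRelations y x Sy Sx where
  lower := h.upper
  upper := h.lower
  comm i j hij := (h.comm j i hij.symm).symm
  braid i h1 h2 := mul_pow_eq_one_comm (h.braid i h2 h1)
  xxy_left i h1 h2 h3 := mul_pow_eq_one_comm (by rw [← mul_assoc]; exact h.xyy_left i h3 h1 h2)
  xxy_right i h1 h2 h3 := mul_pow_eq_one_comm (by rw [← mul_assoc]; exact h.xyy_right i h3 h1 h2)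
  xyy_left i h1 h2 h3 := by
    rw [mul_assoc]; exact mul_pow_eq_one_comm (h.xxy_left i h2 h3 h1)
  xyy_right i h1 h2 h3 := by
    rw [mul_assoc]; exact mul_pow_eq_one_comm (h.xxy_right i h2 h3 h1)

theorem transvectionElement_mul_self (i j : ℕ) :
    transvectionElement x y i j * transvectionElement x y i j = 1 := by
  rcases lt_trichotomy i j with hij | rfl | hij
  · rw [transvectionElement_of_lt hij, h.upper.rootElement_mul_self hij]
  · simp [transvectionElement]
  · rw [transvectionElement_of_gt hij, h.lower.rootElement_mul_self hij]

theorem commute_rootElement_of_disjoint {i k l : ℕ} (hkl : k < l) (hi : i < k ∨ l ≤ i) :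
    Commute (y i) (rootElement x k l) :=
  Commute.rootElement_right hkl fun m _ _ => (h.comm m i (by omega)).symm

/-- For a root of length two this is the order-three relation read through `triple_pow_three_iff`. A
longer root is the commutator of its first two letters with a remainder that commutes with `y i`. -/
theorem bracket_rootElement_left {i l : ℕ} (hl : i + 2 ≤ l) (hy : Sy i)
    (hx : ∀ k, i ≤ k → k < l → Sx k) :
    ⁅y i, rootElement x i l⁆ = rootElement x (i + 1) l := by
  have base : ⁅y i, rootElement x i (i + 2)⁆ = rootElement x (i + 1) (i + 2) := by
    rw [rootElement_succ (by omega), rootElement_succ_self, rootElement_succ_self]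
    exact (triple_pow_three_iff (h.lower.mul_self _) (h.lower.mul_self _) (h.upper.mul_self _)
      (h.comm _ _ (by omega)).symm (h.braid i (hx i (by omega) (by omega)) hy)
      (h.lower.commute_pair i).2).1
      (h.xxy_left i (hx _ (by omega) (by omega)) (hx _ (by omega) (by omega)) hy)
  rcases hl.eq_or_lt with rfl | hl
  · exact base
  · have e := h.lower.rootElement_bracket (a := i) (b := i + 2) (c := l) (by omega) hl
    rw [← e]
    refine commutatorElement_commutatorElement_right base
      (h.commute_rootElement_of_disjoint hl (by omega))
      (h.lower.rootElement_bracket (by omega) hl) ?_ ?_ <;> rw [e] <;>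
    exact h.lower.rootElement_comm (by omega) (by omega) (by omega) (by omega)

theorem bracket_rootElement_right {k i : ℕ} (hk : k < i) (hy : Sy i)
    (hx : ∀ j, k ≤ j → j < i + 1 → Sx j) :
    ⁅y i, rootElement x k (i + 1)⁆ = rootElement x k i := by
  obtain ⟨i, rfl⟩ : ∃ j, i = j + 1 := ⟨i - 1, by omega⟩
  have base : ⁅y (i + 1), rootElement x i (i + 2)⁆ = rootElement x i (i + 1) := by
    rw [rootElement_succ (by omega), rootElement_succ_self]
    have e : ⁅x (i + 1), x i⁆ = ⁅x i, x (i + 1)⁆ :=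
      commutatorElement_symm_of_mul_self rfl
        ((pow_four_eq_one_iff_mul_self (h.lower.mul_self _) (h.lower.mul_self _)).1 (h.lower.pair i))
    rw [← e]
    refine (triple_pow_three_iff (h.lower.mul_self _) (h.lower.mul_self _) (h.upper.mul_self _)
      (h.comm _ _ (by omega)).symm (h.braid (i + 1) (hx _ (by omega) (by omega)) hy)
      (e ▸ (h.lower.commute_pair i).1)).1 ?_
    -- The criterion needs the letters in the order `x (i + 1)`, `x i`, `y (i + 1)`; inverting the
    -- word and rotating it cyclically gives that order.
    have := h.xxy_right i (hx _ (by omega) (by omega)) (hx _ (by omega) (by omega)) hy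
    rw [← inv_eq_one, ← inv_pow, mul_inv_rev, mul_inv_rev,
      inv_eq_self_of_mul_self (h.lower.mul_self _), inv_eq_self_of_mul_self (h.lower.mul_self _),
      inv_eq_self_of_mul_self (h.upper.mul_self _)] at this
    exact mul_pow_eq_one_comm this
  rcases (Nat.lt_succ_iff.1 hk).eq_or_lt with rfl | hk
  · exact base
  · have e := h.lower.rootElement_bracket_symm (a := k) (b := i) (c := i + 2) hk (by omega)
    rw [← e]
    refine commutatorElement_commutatorElement_right base
      (h.commute_rootElement_of_disjoint hk (by omega))
      (h.lower.rootElement_bracket_symm hk (by omega)) ?_ ?_ <;> rw [e] <;>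
    exact h.lower.rootElement_comm (by omega) (by omega) (by omega) (by omega)

/-- With the root cut at `i + 1`, the upper piece commutes with `y i` and the lower piece is
shortened by it to a root commuting with both pieces. -/
theorem commute_rootElement_of_inner {k i l : ℕ} (hk : k < i) (hl : i + 1 < l) (hy : Sy i)
    (hx : ∀ j, k ≤ j → j < l → Sx j) : Commute (y i) (rootElement x k l) := by
  rw [← h.lower.rootElement_bracket_symm (b := i + 1) (by omega) hl]
  exact commute_commutatorElement_of_conj_right
    (h.commute_rootElement_of_disjoint hl (by omega))
    (h.bracket_rootElement_right hk hy fun j h1 h2 => hx j h1 (by omega))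
    (h.lower.rootElement_comm (by omega) (by omega) (by omega) (by omega))
    (h.lower.rootElement_comm (by omega) (by omega) (by omega) (by omega))

end MixedRelations

/-- The Steinberg relations between `1 + E_{i,j}` and `1 + E_{l,k}` for `i < j`, `k < l`, except for
the braid relation. -/
structure OppositeRelations (x y : ℕ → G) (i j k l : ℕ) : Prop where
  comm : k ≠ i → l ≠ j → Commute (rootElement y i j) (rootElement x k l)
  left : k = i → l ≠ j → ⁅rootElement x k l, rootElement y i j⁆ = transvectionElement x y l j
  right : l = j → k ≠ i → ⁅rootElement y i j, rootElement x k l⁆ = transvectionElement x y i k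

namespace MixedRelations

variable (h : MixedRelations x y Sx Sy)

include h

theorem oppositeRelations_succ {i k l : ℕ} (hkl : k < l) (hy : Sy i)
    (hx : ∀ m, k ≤ m → m < l → Sx m) : OppositeRelations x y i (i + 1) k l := by
  refine ⟨fun h1 h2 => ?_, fun h1 h2 => ?_, fun h1 h2 => ?_⟩ <;> rw [rootElement_succ_self]
  · by_cases hd : i < k ∨ l ≤ i
    · exact h.commute_rootElement_of_disjoint hkl hd
    · exact h.commute_rootElement_of_inner (by omega) (by omega) hy hx
  · subst h1
    rw [transvectionElement_of_gt (by omega)]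
    exact commutatorElement_symm_of_mul_self (h.bracket_rootElement_left (by omega) hy hx)
      (h.lower.rootElement_mul_self (by omega))
  · subst h1
    rw [transvectionElement_of_gt (by omega)]
    exact h.bracket_rootElement_right (by omega) hy hx

/-- The induction is on a bound for the length of the upper root, with the lower root arbitrary. A
longer upper root is cut at `i + 1`, or before its last letter for the bracket at the right end, and
the relations of the pieces combine through the commutator lemmas. -/
theorem oppositeRelations (d : ℕ) : ∀ i j k l, i < j → j ≤ i + d → k < l → PathRel Sx Sy i j →
    PathRel Sx Sy l k → OppositeRelations x y i j k l := by
  induction d with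
  | zero => omega
  | succ d ih =>
  intro i j k l hij hd hkl hR hR'
  rcases Nat.lt_or_ge (i + 1) j with hj | hj
  swap
  · obtain rfl : j = i + 1 := by omega
    exact h.oppositeRelations_succ hkl (hR.1 i (by omega) (by omega)) hR'.2
  have sub : ∀ i' j', i ≤ i' → i' ≤ j' → j' ≤ j → PathRel Sx Sy i' j' := fun i' j' h1 h2 h3 =>
    ⟨fun m h4 h5 => hR.1 m (by omega) (by omega), by omega⟩
  have sub' : ∀ l' k', k ≤ k' → k' ≤ l' → l' ≤ l → PathRel Sx Sy l' k' := fun i' j' h1 h2 h3 =>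
    ⟨by omega, fun m h4 h5 => hR'.2 m (by omega) (by omega)⟩
  have comm : ∀ k l, k < l → PathRel Sx Sy l k → k ≠ i → l ≠ j →
      Commute (rootElement y i j) (rootElement x k l) := by
    intro k l hkl hR' hki hlj
    rw [← h.upper.rootElement_bracket (b := i + 1) (by omega) hj]
    -- If the lower root has an end at the cut, one piece need not commute with it. The resulting
    -- bracket is again a root element, and it commutes with what the conjugation lemma requires.
    by_cases hml : l = i + 1
    · subst hml
      have e := (ih i (i + 1) k (i + 1) (by omega) (by omega) hkl
        (sub _ _ (by omega) (by omega) (by omega)) hR').right rfl hki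
      rw [transvectionElement_of_gt (by omega)] at e
      refine commute_commutatorElement_of_conj (h.upper.rootElement_mul_self (by omega)) ?_ e ?_
      · exact (ih (i + 1) j k (i + 1) hj (by omega) hkl (sub _ _ (by omega) (by omega) (by omega))
          hR').comm (by omega) hlj
      · exact (ih (i + 1) j k i hj (by omega) (by omega) (sub _ _ (by omega) (by omega) (by omega))
          ⟨by omega, fun m h4 h5 => hR'.2 m (by omega) (by omega)⟩).comm (by omega) (by omega)
    by_cases hmk : k = i + 1
    · subst hmk
      have e := (ih (i + 1) j (i + 1) l hj (by omega) hkl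
        (sub _ _ (by omega) (by omega) (by omega)) hR').left rfl hlj
      have e' := (ih i (i + 1) (i + 1) l (by omega) (by omega) hkl
        (sub _ _ (by omega) (by omega) (by omega)) hR').comm (by omega) (by omega)
      refine (commute_commutatorElement_of_conj_right e'.symm e ?_ ?_).symm
      · rcases lt_or_gt_of_ne hlj with hlj | hlj
        · rw [transvectionElement_of_lt hlj]
          exact h.upper.rootElement_comm (by omega) (by omega) (by omega) (by omega)
        · rw [transvectionElement_of_gt hlj]
          exact ((ih i (i + 1) j l (by omega) (by omega) hlj
            (sub _ _ (by omega) (by omega) (by omega))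
            ⟨by omega, fun m h4 h5 => hR'.2 m (by omega) (by omega)⟩).comm (by omega)
              (by omega)).symm
      · rcases lt_or_gt_of_ne hlj with hlj | hlj
        · rw [transvectionElement_of_lt hlj]
          exact h.upper.rootElement_comm (by omega) (by omega) (by omega) (by omega)
        · rw [transvectionElement_of_gt hlj]
          exact ((ih (i + 1) j j l (by omega) (by omega) hlj
            (sub _ _ (by omega) (by omega) (by omega))
            ⟨by omega, fun m h4 h5 => hR'.2 m (by omega) (by omega)⟩).comm (by omega)
              (by omega)).symm
    · exact (((ih i (i + 1) k l (by omega) (by omega) hkl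
        (sub _ _ (by omega) (by omega) (by omega)) hR').comm hki hml).symm.commutatorElement_right
        ((ih (i + 1) j k l (by omega) (by omega) hkl
        (sub _ _ (by omega) (by omega) (by omega)) hR').comm hmk hlj).symm).symm
  have comm' : ∀ a b, a ≠ b → PathRel Sx Sy a b → b ≠ i → a ≠ j →
      Commute (transvectionElement x y a b) (rootElement y i j) := by
    intro a b hab hR1 h1 h2
    rcases lt_or_gt_of_ne hab with hab | hab
    · rw [transvectionElement_of_lt hab]
      exact h.upper.rootElement_comm hab hij h1 h2
    · rw [transvectionElement_of_gt hab]
      exact (comm b a hab hR1 h1 h2).symm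
  refine ⟨fun h1 h2 => comm k l hkl hR' h1 h2, fun h1 h2 => ?_, fun h1 h2 => ?_⟩
  · subst h1
    -- Here the lower root would be opposite to the first piece and their bracket is unavailable;
    -- but it is then a single generator, covered by transposing the one-letter case.
    by_cases hl : l = k + 1
    · subst hl
      rw [rootElement_succ_self, transvectionElement_of_lt (by omega)]
      exact h.swap.bracket_rootElement_left hj (hR'.2 k (by omega) (by omega)) hR.1
    have e := h.upper.rootElement_bracket (a := k) (b := k + 1) (c := j) (by omega) hj
    rw [← e]
    refine commutatorElement_commutatorElement_right
      ((ih k (k + 1) k l (by omega) (by omega) hkl (sub _ _ (by omega) (by omega) (by omega))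
        hR').left rfl hl) ?_ (n := transvectionElement x y l j)
        (c := transvectionElement x y l (k + 1)) ?_ ?_ ?_
    · exact ((ih (k + 1) j k l hj (by omega) hkl (sub _ _ (by omega) (by omega) (by omega))
        hR').comm (by omega) h2).symm
    · rw [transvectionElement_of_gt (by omega)]
      exact (ih (k + 1) j (k + 1) l hj (by omega) (by omega)
        (sub _ _ (by omega) (by omega) (by omega))
        (sub' _ _ (by omega) (by omega) (by omega))).left rfl h2
    · rw [e]
      exact comm' _ _ (by omega) (sub' _ _ (by omega) (by omega) (by omega)) (by omega) h2
    · rw [e]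
      exact comm' _ _ h2 (hR'.trans hR) (by omega) h2
  · subst h1
    obtain ⟨j, rfl⟩ : ∃ j', l = j' + 1 := ⟨l - 1, by omega⟩
    by_cases hk : k = j
    · subst hk
      rw [rootElement_succ_self, transvectionElement_of_lt (by omega)]
      exact commutatorElement_symm_of_mul_self
        (h.swap.bracket_rootElement_right (by omega) (hR'.2 k (by omega) (by omega)) hR.1)
        (h.upper.rootElement_mul_self (by omega))
    have e := h.upper.rootElement_bracket_symm (a := i) (b := j) (c := j + 1) (by omega)
      (by omega)
    refine commutatorElement_symm_of_mul_self ?_ (h.transvectionElement_mul_self _ _)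
    rw [← e]
    refine commutatorElement_commutatorElement_right
      (commutatorElement_symm_of_mul_self ((ih j (j + 1) k (j + 1) (by omega) (by omega) hkl
        (sub _ _ (by omega) (by omega) (by omega)) hR').right rfl hk)
        (h.transvectionElement_mul_self _ _)) ?_ (n := transvectionElement x y i k)
        (c := transvectionElement x y j k) ?_ ?_ ?_
    · exact ((ih i j k (j + 1) (by omega) (by omega) hkl (sub _ _ (by omega) (by omega) (by omega))
        hR').comm h2 (by omega)).symm
    · rw [transvectionElement_of_gt (by omega)]
      exact commutatorElement_symm_of_mul_self ((ih i j k j (by omega) (by omega) (by omega)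
        (sub _ _ (by omega) (by omega) (by omega))
        (sub' _ _ (by omega) (by omega) (by omega))).right rfl h2)
        (h.transvectionElement_mul_self _ _)
    · rw [e]
      exact comm' _ _ (by omega) (sub' _ _ (by omega) (by omega) (by omega)) h2 (by omega)
    · rw [e]
      exact comm' _ _ h2.symm (hR.trans hR') h2 (by omega)

/-- The Weyl element `x i * y i * x i = y i * x i * y i` conjugates both roots of the pair `(i + 1,
j)` to those of the pair `(i, j)`, so the relation propagates from a single pair of generators. -/
theorem braid_rootElement {i j : ℕ} (hij : i < j) (hR : PathRel Sx Sy i j)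
    (hR' : PathRel Sx Sy j i) : (rootElement x i j * rootElement y i j) ^ 3 = 1 := by
  obtain ⟨d, hd⟩ : ∃ d, j = i + 1 + d := ⟨j - (i + 1), by omega⟩
  induction d generalizing i with
  | zero =>
    subst hd
    rw [add_zero, rootElement_succ_self, rootElement_succ_self]
    exact h.braid i (hR'.2 i (by omega) (by omega)) (hR.1 i (by omega) (by omega))
  | succ d ih =>
    have hRi : PathRel Sx Sy i (i + 1) := ⟨fun m h1 h2 => hR.1 m h1 (by omega), by omega⟩
    have hRi' : PathRel Sx Sy (i + 1) i := ⟨by omega, fun m h1 h2 => hR'.2 m h1 (by omega)⟩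
    have hb := h.braid i (hR'.2 i (by omega) (by omega)) (hR.1 i (by omega) (by omega))
    have hw := (braid_iff (h.lower.mul_self _) (h.upper.mul_self _)).1 hb
    have ih' := ih (i := i + 1) (by omega) (hRi'.trans hR) (hR'.trans hRi) (by omega)
    have e1 : (x i * y i * x i) * rootElement x (i + 1) j * (x i * y i * x i)⁻¹ =
        rootElement x i j := by
      apply weyl_conj
      · rw [← rootElement_succ_self (y := x) i]
        exact h.lower.rootElement_bracket (by omega) (by omega)
      · exact h.bracket_rootElement_left (by omega) (hR.1 i (by omega) (by omega)) hR'.2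
      · rw [← rootElement_succ_self (y := x) i]
        exact h.lower.rootElement_comm (by omega) (by omega) (by omega) (by omega)
      · exact h.commute_rootElement_of_disjoint (by omega) (by omega)
      · exact h.lower.rootElement_comm (by omega) (by omega) (by omega) (by omega)
      · exact h.lower.rootElement_mul_self (by omega)
    have e2 : (y i * x i * y i) * rootElement y (i + 1) j * (y i * x i * y i)⁻¹ =
        rootElement y i j := by
      apply weyl_conj
      · rw [← rootElement_succ_self (y := y) i]
        exact h.upper.rootElement_bracket (by omega) (by omega)
      · exact h.swap.bracket_rootElement_left (by omega) (hR'.2 i (by omega) (by omega)) hR.1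
      · rw [← rootElement_succ_self (y := y) i]
        exact h.upper.rootElement_comm (by omega) (by omega) (by omega) (by omega)
      · exact h.swap.commute_rootElement_of_disjoint (by omega) (by omega)
      · exact h.upper.rootElement_comm (by omega) (by omega) (by omega) (by omega)
      · exact h.upper.rootElement_mul_self (by omega)
    rw [← hw] at e2
    rw [← e1, ← e2, conj_mul, conj_pow, ih', mul_one, mul_inv_cancel]

theorem steinbergRelations : SteinbergRelations (PathRel Sx Sy) (transvectionElement x y) where
  trans _ _ _ := PathRel.trans
  mul_self := h.transvectionElement_mul_self
  comm i j k l hij hkl hR hR' hjk hil := by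
    rcases lt_or_gt_of_ne hij with h1 | h1 <;> rcases lt_or_gt_of_ne hkl with h2 | h2
    · rw [transvectionElement_of_lt h1, transvectionElement_of_lt h2]
      exact h.upper.rootElement_comm h1 h2 hjk hil
    · rw [transvectionElement_of_lt h1, transvectionElement_of_gt h2]
      exact (h.oppositeRelations j i j l k h1 (by omega) h2 hR hR').comm hil.symm hjk.symm
    · rw [transvectionElement_of_gt h1, transvectionElement_of_lt h2]
      exact ((h.oppositeRelations l k l j i h2 (by omega) h1 hR' hR).comm hjk hil).symm
    · rw [transvectionElement_of_gt h1, transvectionElement_of_gt h2]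
      exact h.lower.rootElement_comm h1 h2 hil hjk
  bracket i j k hij hjk hik hR hR' := by
    rcases lt_or_gt_of_ne hij with h1 | h1 <;> rcases lt_or_gt_of_ne hjk with h2 | h2
    · rw [transvectionElement_of_lt h1, transvectionElement_of_lt h2,
        transvectionElement_of_lt (h1.trans h2)]
      exact h.upper.rootElement_bracket h1 h2
    · rw [transvectionElement_of_lt h1, transvectionElement_of_gt h2]
      exact (h.oppositeRelations j i j k j h1 (by omega) h2 hR hR').right rfl hik.symm
    · rw [transvectionElement_of_gt h1, transvectionElement_of_lt h2]
      exact (h.oppositeRelations k j k j i h2 (by omega) h1 hR' hR).left rfl hik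
    · rw [transvectionElement_of_gt h1, transvectionElement_of_gt h2,
        transvectionElement_of_gt (h2.trans h1)]
      exact h.lower.rootElement_bracket_symm h2 h1
  braid i j hij hR hR' := by
    rw [← braid_iff (h.transvectionElement_mul_self _ _) (h.transvectionElement_mul_self _ _)]
    rcases lt_or_gt_of_ne hij with h1 | h1
    · rw [transvectionElement_of_lt h1, transvectionElement_of_gt h1]
      exact mul_pow_eq_one_comm (h.braid_rootElement h1 hR hR')
    · rw [transvectionElement_of_gt h1, transvectionElement_of_lt h1]
      exact h.braid_rootElement h1 hR' hR

end MixedRelations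

end Mixed

/-! ### Subgroups generated by sets of roots. -/

section RootSubgroups

variable {ι G : Type*} [Group G]

/-- The subgroup generated by the `t i j` with `R i j` and `P i j`. -/
def rootSubgroup (R : ι → ι → Prop) (t : ι → ι → G) (P : ι → ι → Prop) : Subgroup G :=
  Subgroup.closure {g | ∃ i j, i ≠ j ∧ R i j ∧ P i j ∧ t i j = g}

theorem mem_rootSubgroup {R : ι → ι → Prop} {t : ι → ι → G} {P : ι → ι → Prop} {i j : ι}
    (hij : i ≠ j) (hR : R i j) (hP : P i j) : t i j ∈ rootSubgroup R t P :=
  Subgroup.subset_closure ⟨i, j, hij, hR, hP, rfl⟩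

theorem rootSubgroup_mono {R : ι → ι → Prop} {t : ι → ι → G} {P Q : ι → ι → Prop}
    (h : ∀ i j, i ≠ j → R i j → P i j → Q i j) : rootSubgroup R t P ≤ rootSubgroup R t Q := by
  refine Subgroup.closure_mono ?_
  rintro _ ⟨i, j, hij, hR, hP, rfl⟩
  exact ⟨i, j, hij, hR, h i j hij hR hP, rfl⟩

namespace SteinbergRelations

variable {R : ι → ι → Prop} {t : ι → ι → G} (h : SteinbergRelations R t)

include h

theorem inv_eq_self (i j : ι) : (t i j)⁻¹ = t i j := inv_eq_self_of_mul_self (h.mul_self i j)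

theorem bracket_symm {i j k : ι} (hij : i ≠ j) (hjk : j ≠ k) (hik : i ≠ k) (h1 : R i j)
    (h2 : R j k) : ⁅t j k, t i j⁆ = t i k :=
  commutatorElement_symm_of_mul_self (h.bracket i j k hij hjk hik h1 h2) (h.mul_self i k)

/-- Reversing the indices corresponds to inverse transpose, under which statements about columns
become statements about rows. -/
theorem dual : SteinbergRelations (fun i j => R j i) (fun i j => t j i) where
  trans _ _ _ h1 h2 := h.trans _ _ _ h2 h1
  mul_self i j := h.mul_self j i
  comm i j k l hij hkl h1 h2 h3 h4 := h.comm j i l k hij.symm hkl.symm h1 h2 h4 h3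
  bracket _ _ _ hij hjk hik h1 h2 := h.bracket_symm hjk.symm hij.symm hik.symm h2 h1
  braid i j hij h1 h2 := h.braid j i hij.symm h1 h2

/-- Every element of a root subgroup is a product of generators; the generators are involutions. -/
theorem rootSubgroup_induction {P : ι → ι → Prop} {p : G → Prop} (one : p 1)
    (mul : ∀ i j, i ≠ j → R i j → P i j → ∀ g ∈ rootSubgroup R t P, p g → p (t i j * g))
    {g : G} (hg : g ∈ rootSubgroup R t P) : p g := by
  refine Subgroup.closure_induction_left (p := fun g _ => p g) one ?_ ?_ hg
  · rintro _ ⟨i, j, hij, hR, hP, rfl⟩ g hg hpg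
    exact mul i j hij hR hP g hg hpg
  · rintro _ ⟨i, j, hij, hR, hP, rfl⟩ g hg hpg
    rw [h.inv_eq_self]
    exact mul i j hij hR hP g hg hpg

/-- Conjugation by `t i j` multiplies `t k l` by at most one further root element, `t i l` or `t k
j`; only its membership has to be checked. -/
theorem conj_mem {A : Subgroup G} {i j k l : ι} (hij : i ≠ j) (hkl : k ≠ l) (h1 : R i j)
    (h2 : R k l) (hA : t k l ∈ A) (hne : i ≠ l ∨ j ≠ k) (hjk : j = k → t i l ∈ A)
    (hil : i = l → t k j ∈ A) : t i j * t k l * (t i j)⁻¹ ∈ A := by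
  have key : ∀ c, ⁅t i j, t k l⁆ = c → c ∈ A → t i j * t k l * (t i j)⁻¹ ∈ A := fun c hc hcA => by
    rw [commutatorElement_def, mul_inv_eq_iff_eq_mul] at hc
    rw [hc]
    exact A.mul_mem hcA hA
  by_cases e1 : j = k
  · subst e1
    exact key _ (h.bracket i j l hij hkl (by tauto) h1 h2) (hjk rfl)
  by_cases e2 : i = l
  · subst e2
    exact key _ (h.bracket_symm hkl hij (Ne.symm e1) h2 h1) (hil rfl)
  · rw [(h.comm i j k l hij hkl h1 h2 e1 e2).eq, mul_inv_cancel_right]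
    exact hA

/-- If all conjugates of generators of `rootSubgroup R t Q` by generators of `rootSubgroup R t P`
stay inside, then the latter normalizes the former. -/
theorem rootSubgroup_normalizes {P Q : ι → ι → Prop}
    (hPQ : ∀ i j k l, i ≠ j → k ≠ l → R i j → R k l → P i j → Q k l →
      t i j * t k l * (t i j)⁻¹ ∈ rootSubgroup R t Q) {g u : G} (hg : g ∈ rootSubgroup R t P)
    (hu : u ∈ rootSubgroup R t Q) : ∃ u' ∈ rootSubgroup R t Q, g * u = u' * g := by
  refine h.rootSubgroup_induction (p := fun g => ∀ u ∈ rootSubgroup R t Q,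
    ∃ u' ∈ rootSubgroup R t Q, g * u = u' * g) ?_ ?_ hg u hu
  · exact fun u hu => ⟨u, hu, by simp⟩
  · intro i j hij hR hP g _ ih u hu
    obtain ⟨u', hu', e⟩ := ih u hu
    refine ⟨t i j * u' * (t i j)⁻¹, ?_, by rw [mul_assoc, e]; group⟩
    have : rootSubgroup R t Q ≤ (rootSubgroup R t Q).comap (MulAut.conj (t i j)).toMonoidHom := by
      refine (Subgroup.closure_le _).2 ?_
      rintro _ ⟨k, l, hkl, hR', hQ, rfl⟩
      exact hPQ i j k l hij hkl hR hR' hP hQ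
    exact this hu'

theorem rootSubgroup_normalizes' {P Q : ι → ι → Prop}
    (hPQ : ∀ i j k l, i ≠ j → k ≠ l → R i j → R k l → P i j → Q k l →
      t i j * t k l * (t i j)⁻¹ ∈ rootSubgroup R t Q) {g u : G} (hg : g ∈ rootSubgroup R t P)
    (hu : u ∈ rootSubgroup R t Q) : ∃ u' ∈ rootSubgroup R t Q, u * g = g * u' := by
  obtain ⟨u', hu', e⟩ := h.rootSubgroup_normalizes hPQ (inv_mem hg) hu
  exact ⟨u', hu', by rw [← mul_inv_eq_iff_eq_mul] at e; rw [← e]; group⟩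

/-- The root elements of one column are commuting involutions, so all occurrences of `t q p` can be
collected into a single factor or none. -/
theorem column_split {p q : ι} (hqp : q ≠ p) (hR : R q p) {P : ι → Prop} {u : G}
    (hu : u ∈ rootSubgroup R t (fun i j => j = p ∧ P i)) :
    ∃ u' ∈ rootSubgroup R t (fun i j => j = p ∧ P i ∧ i ≠ q), u = u' ∨ u = t q p * u' := by
  refine h.rootSubgroup_induction (p := fun u =>
    ∃ u' ∈ rootSubgroup R t (fun i j => j = p ∧ P i ∧ i ≠ q), u = u' ∨ u = t q p * u')
    ⟨1, one_mem _, Or.inl rfl⟩ ?_ hu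
  rintro i j hij hR' ⟨rfl, hP⟩ g - ⟨u', hu', e⟩
  by_cases hiq : i = q
  · subst hiq
    refine ⟨u', hu', ?_⟩
    rcases e with rfl | rfl
    · exact Or.inr rfl
    · left
      rw [← mul_assoc, h.mul_self, one_mul]
  · refine ⟨t i j * u', mul_mem (mem_rootSubgroup hij hR' ⟨rfl, hP, hiq⟩) hu', ?_⟩
    rcases e with rfl | rfl
    · exact Or.inl rfl
    · right
      rw [← mul_assoc, ← mul_assoc,
        (h.comm i j q j hij hqp hR' hR (Ne.symm hqp) hij).eq]

end SteinbergRelations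

end RootSubgroups

/-! ### Representations by transvections. -/

section Representation

open Matrix

variable {ι G : Type*} [Group G] [Fintype ι] [DecidableEq ι]

/-- A representation in which `t i j` acts as `1 + E_{i,j}`. -/
def IsTransvectionRep (R : ι → ι → Prop) (t : ι → ι → G)
    (ρ : G →* Matrix ι ι (ZMod 2)) : Prop :=
  ∀ i j, i ≠ j → R i j → ρ (t i j) = 1 + single i j 1

theorem one_add_single_mulVec (i j : ι) (v : ι → ZMod 2) :
    (1 + single i j 1 : Matrix ι ι (ZMod 2)) *ᵥ v = v + Pi.single i (v j) := by
  rw [add_mulVec, one_mulVec, single_mulVec, one_mul]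
  rfl

/-- The contragredient representation. -/
def contragredient (ρ : G →* Matrix ι ι (ZMod 2)) : G →* Matrix ι ι (ZMod 2) where
  toFun g := (ρ g⁻¹)ᵀ
  map_one' := by simp
  map_mul' a b := by simp [transpose_mul]

variable {R : ι → ι → Prop} {t : ι → ι → G} {ρ : G →* Matrix ι ι (ZMod 2)}

namespace SteinbergRelations

variable (h : SteinbergRelations R t) (hρ : IsTransvectionRep R t ρ)

include h hρ

theorem isTransvectionRep_contragredient :
    IsTransvectionRep (fun i j => R j i) (fun i j => t j i) (contragredient ρ) := by
  intro i j hij hR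
  change (ρ (t j i)⁻¹)ᵀ = _
  rw [h.inv_eq_self, hρ j i hij.symm hR]
  simp

theorem rep_mulVec_apply {P : ι → ι → Prop} {r : ι} (hP : ∀ i j, P i j → i ≠ r) {g : G}
    (hg : g ∈ rootSubgroup R t P) (v : ι → ZMod 2) : (ρ g *ᵥ v) r = v r := by
  refine h.rootSubgroup_induction (p := fun g => (ρ g *ᵥ v) r = v r) (by simp) ?_ hg
  intro i j hij hR hPij g _ ih
  rw [map_mul, ← mulVec_mulVec, hρ i j hij hR, one_add_single_mulVec, Pi.add_apply, ih,
    Pi.single_eq_of_ne (hP i j hPij).symm, add_zero]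

theorem rep_mulVec_single {P : ι → ι → Prop} {c : ι} (hP : ∀ i j, P i j → j ≠ c) {g : G}
    (hg : g ∈ rootSubgroup R t P) : ρ g *ᵥ Pi.single c 1 = Pi.single c 1 := by
  refine h.rootSubgroup_induction (p := fun g => ρ g *ᵥ Pi.single c 1 = Pi.single c 1)
    (by rw [map_one, one_mulVec]) ?_ hg
  intro i j hij hR hPij g _ ih
  rw [map_mul, ← mulVec_mulVec, ih, hρ i j hij hR, one_add_single_mulVec,
    Pi.single_eq_of_ne (hP i j hPij), Pi.single_zero, add_zero]

/-- In a column subgroup the factor `t q p` is visible as the `q`-th coordinate of the image of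
`e_p`; if `e_p` is fixed, the factors can be removed one after the other. -/
theorem eq_one_of_column {p : ι} (T : Finset ι) : ∀ u ∈ rootSubgroup R t (fun i j => j = p ∧ i ∈ T),
    ρ u *ᵥ Pi.single p 1 = Pi.single p 1 → u = 1 := by
  induction T using Finset.induction_on with
  | empty =>
    intro u hu _
    refine h.rootSubgroup_induction (p := fun u => u = 1) rfl ?_ hu
    simp
  | insert q T hq ih =>
    intro u hu hfix
    by_cases hqp : q ≠ p ∧ R q p
    · obtain ⟨u', hu', e⟩ := h.column_split hqp.1 hqp.2 hu
      have hu'' : u' ∈ rootSubgroup R t (fun i j => j = p ∧ i ∈ T) :=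
        rootSubgroup_mono (fun i j _ _ hP =>
          ⟨hP.1, (Finset.mem_insert.1 hP.2.1).resolve_left hP.2.2⟩) hu'
      rcases e with rfl | rfl
      · exact ih _ hu'' hfix
      · exfalso
        have h1 := h.rep_mulVec_apply hρ (r := q) (fun i j hP => hP.2.2) hu'
          (Pi.single p 1)
        have h2 := h.rep_mulVec_apply hρ (r := p) (P := fun i j => j = p ∧ i ≠ p)
          (fun i j hP => hP.2) (g := u') (rootSubgroup_mono (fun i j hij _ hP => ⟨hP.1, hP.1 ▸ hij⟩)
          hu') (Pi.single p 1)
        have h3 := congrFun hfix q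
        rw [map_mul, ← mulVec_mulVec, hρ q p hqp.1 hqp.2, one_add_single_mulVec, Pi.add_apply, h1,
          h2] at h3
        simp at h3
    · refine ih u (rootSubgroup_mono (fun i j hij hR hP => ⟨hP.1, ?_⟩) hu) hfix
      rcases Finset.mem_insert.1 hP.2 with rfl | hi
      · exact (hqp ⟨hP.1 ▸ hij, hP.1 ▸ hR⟩).elim
      · exact hi

end SteinbergRelations

end Representation

/-! ### A coset decomposition relative to the stabilizer of a basis vector. -/

section CosetDecomposition

variable {ι G : Type*} [Group G]

/-- The product set `V H ∪ ⋃_q t_{p,q} V H`, where `V` is generated by the `t i p` and `H` by the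
`t i j` with `j ≠ p`. -/
def columnCosets (R : ι → ι → Prop) (t : ι → ι → G) (T : Finset ι) (p : ι) : Set G :=
  {g | ∃ u ∈ rootSubgroup R t (fun i j => j = p ∧ i ∈ T),
    ∃ k ∈ rootSubgroup R t (fun i j => j ≠ p ∧ i ∈ T ∧ j ∈ T),
      g = u * k ∨ ∃ q ∈ T, q ≠ p ∧ R p q ∧ R q p ∧ g = t p q * u * k}

namespace SteinbergRelations

variable {R : ι → ι → Prop} {t : ι → ι → G} (h : SteinbergRelations R t) {T : Finset ι} {p : ι}

include h

omit h in
theorem columnCosets_mul_right {g k : G} (hg : g ∈ columnCosets R t T p)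
    (hk : k ∈ rootSubgroup R t (fun i j => j ≠ p ∧ i ∈ T ∧ j ∈ T)) :
    g * k ∈ columnCosets R t T p := by
  obtain ⟨u, hu, k', hk', e⟩ := hg
  refine ⟨u, hu, k' * k, mul_mem hk' hk, ?_⟩
  rcases e with rfl | ⟨q, hq, h1, h2, h3, rfl⟩
  · exact Or.inl (mul_assoc _ _ _)
  · exact Or.inr ⟨q, hq, h1, h2, h3, mul_assoc _ _ _⟩

omit h in
theorem mem_columnCosets {u k : G} (hu : u ∈ rootSubgroup R t (fun i j => j = p ∧ i ∈ T))
    (hk : k ∈ rootSubgroup R t (fun i j => j ≠ p ∧ i ∈ T ∧ j ∈ T)) :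
    u * k ∈ columnCosets R t T p := ⟨u, hu, k, hk, Or.inl rfl⟩

omit h in
theorem mul_mem_columnCosets {u k : G} {q : ι} (hq : q ∈ T) (hqp : q ≠ p) (h1 : R p q) (h2 : R q p)
    (hu : u ∈ rootSubgroup R t (fun i j => j = p ∧ i ∈ T))
    (hk : k ∈ rootSubgroup R t (fun i j => j ≠ p ∧ i ∈ T ∧ j ∈ T)) :
    t p q * u * k ∈ columnCosets R t T p := ⟨u, hu, k, hk, Or.inr ⟨q, hq, hqp, h1, h2, rfl⟩⟩

theorem mul_column {i j : ι} (hij : i ≠ j) (hR : R i j) (hi : i ∈ T) (hip : i ≠ p) (hjp : j ≠ p)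
    {u : G} (hu : u ∈ rootSubgroup R t (fun i j => j = p ∧ i ∈ T)) :
    ∃ u' ∈ rootSubgroup R t (fun i j => j = p ∧ i ∈ T), t i j * u = u' * t i j := by
  refine h.rootSubgroup_normalizes (P := fun k l => k = i ∧ l = j) ?_
    (mem_rootSubgroup hij hR ⟨rfl, rfl⟩) hu
  rintro _ _ k l - hkl h1 h2 ⟨rfl, rfl⟩ ⟨rfl, hk⟩
  refine h.conj_mem hij hkl h1 h2 (mem_rootSubgroup hkl h2 ⟨rfl, hk⟩) (Or.inl hip) ?_
    fun e => (hip e).elim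
  rintro rfl
  exact mem_rootSubgroup hip (h.trans _ _ _ h1 h2) ⟨rfl, hi⟩

/-- A column element without the factor `t j p` normalizes the group generated by the `t k j`, so `t
p j` can be pushed to its right, leaving a factor in column `j`. -/
theorem row_mul_column {j : ι} (hpj : p ≠ j) (hp : p ∈ T) (hj : j ∈ T) (hR : R p j) {u : G}
    (hu : u ∈ rootSubgroup R t (fun k l => l = p ∧ k ∈ T ∧ k ≠ j)) :
    ∃ k ∈ rootSubgroup R t (fun i j => j ≠ p ∧ i ∈ T ∧ j ∈ T), t p j * u = u * k := by
  suffices ∃ k ∈ rootSubgroup R t (fun k l => l = j ∧ k ∈ T), t p j * u = u * k by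
    obtain ⟨k, hk, e⟩ := this
    exact ⟨k, rootSubgroup_mono (fun a b _ _ hP => ⟨hP.1 ▸ hpj.symm, hP.2, hP.1 ▸ hj⟩) hk, e⟩
  refine h.rootSubgroup_normalizes' ?_ hu (mem_rootSubgroup hpj hR ⟨rfl, hp⟩)
  rintro i _ k _ hij hkl h1 h2 ⟨rfl, hi, hi'⟩ ⟨rfl, hk⟩
  refine h.conj_mem hij hkl h1 h2 (mem_rootSubgroup hkl h2 ⟨rfl, hk⟩) (Or.inl hi') ?_
    fun e => (hi' e).elim
  rintro rfl
  exact mem_rootSubgroup hi' (h.trans _ _ _ h1 h2) ⟨rfl, hi⟩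

/-- A row element `t p j` gives a new coset only if `R j p` holds; otherwise `u` cannot contain `t j
p`, and `t p j` passes to the right of it. -/
theorem mul_mem_columnCosets_of_mem_column {i j : ι} (hij : i ≠ j) (hR : R i j) (hi : i ∈ T)
    (hj : j ∈ T) {u : G} (hu : u ∈ rootSubgroup R t (fun i j => j = p ∧ i ∈ T)) :
    t i j * u ∈ columnCosets R t T p := by
  by_cases hjp : j = p
  · subst hjp
    simpa using mem_columnCosets (mul_mem (mem_rootSubgroup hij hR ⟨rfl, hi⟩) hu) (one_mem _)
  by_cases hip : i = p
  · subst hip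
    by_cases hR' : R j i
    · simpa using mul_mem_columnCosets hj hjp hR hR' hu (one_mem _)
    · obtain ⟨k, hk, e⟩ := h.row_mul_column hij hi hj hR (u := u) (rootSubgroup_mono
        (fun a b _ hab hP => ⟨hP.1, hP.2, by rintro rfl; exact hR' (hP.1 ▸ hab)⟩) hu)
      rw [e]
      exact mem_columnCosets hu hk
  · obtain ⟨u', hu', e⟩ := h.mul_column hij hR hi hip hjp hu
    rw [e]
    exact mem_columnCosets hu' (mem_rootSubgroup hij hR ⟨hjp, hi, hj⟩)

/-- Two row elements must be reduced to at most one. If `u` lacks `t q p` or `t j p`, one of the two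
row elements passes to the right of `u`. If `u` contains both factors, the image of `e_p` under the
product has `p`-th coordinate `1 + 1 + 1 = 1`, which suggests that no row element is needed; a
computation with the indices `p`, `q`, `j` confirms it. -/
theorem row_mul_row_mul_column {j q : ι} (hp : p ∈ T) (hj : j ∈ T) (hq : q ∈ T) (hpj : p ≠ j)
    (hpq : p ≠ q) (hRj : R p j) (hRq : R p q) (hRq' : R q p) {u : G}
    (hu : u ∈ rootSubgroup R t (fun i j => j = p ∧ i ∈ T)) :
    t p j * (t p q * u) ∈ columnCosets R t T p := by
  by_cases hjq : j = q
  · subst hjq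
    rw [← mul_assoc, h.mul_self, one_mul]
    simpa using mem_columnCosets hu (one_mem _)
  have hcomm := h.comm p j p q hpj hpq hRj hRq hpj.symm hpq
  by_cases hRj' : R j p
  swap
  · obtain ⟨k, hk, e⟩ := h.row_mul_column hpj hp hj hRj (u := u) (rootSubgroup_mono
      (fun a b _ hab hP => ⟨hP.1, hP.2, by rintro rfl; exact hRj' (hP.1 ▸ hab)⟩) hu)
    rw [← mul_assoc, hcomm.eq, mul_assoc, e, ← mul_assoc]
    exact mul_mem_columnCosets hq hpq.symm hRq hRq' hu hk
  obtain ⟨u1, hu1, rfl | rfl⟩ := h.column_split hpq.symm hRq' hu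
  · obtain ⟨k, hk, e⟩ := h.row_mul_column hpq hp hq hRq hu1
    rw [e, ← mul_assoc]
    exact mul_mem_columnCosets hj hpj.symm hRj hRj' hu hk
  obtain ⟨u2, hu2, rfl | rfl⟩ := h.column_split hpj.symm hRj' hu1
  · obtain ⟨k, hk, e⟩ := h.row_mul_column hpj hp hj hRj (u := t q p * u1)
      (mul_mem (mem_rootSubgroup hpq.symm hRq' ⟨rfl, hq, Ne.symm hjq⟩)
        (rootSubgroup_mono (fun a b _ _ hP => ⟨hP.1, hP.2.1.1, hP.2.2⟩) hu2))
    rw [← mul_assoc, hcomm.eq, mul_assoc, e, ← mul_assoc]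
    exact mul_mem_columnCosets hq hpq.symm hRq hRq' hu hk
  have hqj : R q j := h.trans _ _ _ hRq' hRj
  have hjq' : R j q := h.trans _ _ _ hRj' hRq
  have hne : q ≠ j := Ne.symm hjq
  have hu2' : u2 ∈ rootSubgroup R t (fun k l => l = p ∧ k ∈ T ∧ k ≠ q) :=
    rootSubgroup_mono (fun a b _ _ hP => ⟨hP.1, hP.2.1⟩) hu2
  have cu : Commute (t q j) u2 := by
    refine h.rootSubgroup_induction (p := fun g => Commute (t q j) g) (Commute.one_right _) ?_ hu2
    rintro a b hab hR' ⟨rfl, -, ha⟩ g - hg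
    exact (h.comm q j a b hne hab hqj hR' ha.symm hpq.symm).mul_right hg
  have cu' : Commute (t j q) u2 := by
    refine h.rootSubgroup_induction (p := fun g => Commute (t j q) g) (Commute.one_right _) ?_ hu2
    rintro a b hab hR' ⟨rfl, ha, -⟩ g - hg
    exact (h.comm j q a b hjq hab hjq' hR' ha.2.symm hpj.symm).mul_right hg
  have e1 : t p j * t p q = t q j * t p q * t q j := by
    rw [← h.bracket_symm hpq hne hpj hRq hqj, commutatorElement_def, inv_mul_cancel_right,
      h.inv_eq_self]
  have e2 : t q p * t j p = t q j * t j p * t q j := by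
    rw [← h.bracket q j p hne hpj.symm hpq.symm hqj hRj', commutatorElement_def,
      inv_mul_cancel_right, h.inv_eq_self]
  have e3 : t p q * t j p = t j p * t j q * t p q := by
    rw [(h.comm j p j q hpj.symm hjq hRj' hjq' hpj hjq).eq,
      ← h.bracket_symm hpj.symm hpq hjq hRj' hRq, commutatorElement_def, inv_mul_cancel_right,
      inv_mul_cancel_right]
  have e4 : ∀ g, t q j * (t q j * g) = g := fun g => by rw [← mul_assoc, h.mul_self, one_mul]
  obtain ⟨k, hk, e⟩ := h.row_mul_column hpq hp hq hRq hu2'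
  have key : t p j * (t p q * (t q p * (t j p * u2))) =
      (t q p * t j p * u2) * (t q j * t j q * k * t q j) := by
    calc t p j * (t p q * (t q p * (t j p * u2)))
        = (t p j * t p q) * (t q p * t j p) * u2 := by simp only [mul_assoc]
      _ = t q j * (t p q * t j p) * t q j * u2 := by
        rw [e1, e2]; simp only [mul_assoc, e4]
      _ = (t q j * t j p * t q j) * t q j * t j q * t p q * t q j * u2 := by
        rw [e3]; simp only [mul_assoc, e4]
      _ = t q p * t j p * t q j * t j q * (t p q * u2) * t q j := by
        rw [← e2]; simp only [mul_assoc, cu.eq]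
      _ = t q p * t j p * (t q j * (t j q * u2)) * k * t q j := by
        rw [e]; simp only [mul_assoc]
      _ = t q p * t j p * ((t q j * u2) * t j q) * k * t q j := by
        rw [cu'.eq]; simp only [mul_assoc]
      _ = _ := by rw [cu.eq]; simp only [mul_assoc]
  rw [key]
  refine mem_columnCosets (mul_mem (mul_mem ?_ ?_) ?_) (mul_mem (mul_mem (mul_mem ?_ ?_) hk) ?_)
  · exact mem_rootSubgroup hpq.symm hRq' ⟨rfl, hq⟩
  · exact mem_rootSubgroup hpj.symm hRj' ⟨rfl, hj⟩
  · exact rootSubgroup_mono (fun a b _ _ hP => ⟨hP.1, hP.2.1.1⟩) hu2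
  · exact mem_rootSubgroup hne hqj ⟨hpj.symm, hq, hj⟩
  · exact mem_rootSubgroup hjq hjq' ⟨hpq.symm, hj, hq⟩
  · exact mem_rootSubgroup hne hqj ⟨hpj.symm, hq, hj⟩

/-- For the pair `t q p`, `t p q` the braid relation brings a row element back to the front. In the
other cases the generator passes `t p q` at the cost of at most one bracket, which is absorbed on
the right or is a second row element. -/
theorem mul_row_mul_column {i j q : ι} (hp : p ∈ T) (hi : i ∈ T) (hj : j ∈ T) (hq : q ∈ T)
    (hij : i ≠ j) (hR : R i j) (hpq : p ≠ q) (hRq : R p q) (hRq' : R q p) {u : G}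
    (hu : u ∈ rootSubgroup R t (fun i j => j = p ∧ i ∈ T)) :
    t i j * (t p q * u) ∈ columnCosets R t T p := by
  by_cases hjp : j = p
  · subst hjp
    by_cases hiq : i = q
    · subst hiq
      obtain ⟨u', hu', rfl | rfl⟩ := h.column_split hij hR hu
      · obtain ⟨k, hk, e⟩ := h.row_mul_column hpq hp hq hRq hu'
        rw [e, ← mul_assoc]
        exact mem_columnCosets (mul_mem (mem_rootSubgroup hij hR ⟨rfl, hi⟩) hu) hk
      · obtain ⟨k, hk, e⟩ := h.row_mul_column hpq hp hq hRq hu'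
        have : t i j * (t j i * (t i j * u')) = t j i * (t i j * u') * k := by
          rw [← mul_assoc, ← mul_assoc, h.braid i j hij hR hRq, mul_assoc, e]
          simp only [mul_assoc]
        rw [this]
        exact mul_mem_columnCosets hq hij hRq hR hu hk
    · have hRiq := h.trans _ _ _ hR hRq
      obtain ⟨u', hu', e⟩ := h.mul_column hiq hRiq hi hij hpq.symm hu
      have : t i j * (t j q * u) = t j q * (t i j * u') * t i q := by
        calc t i j * (t j q * u) = t i q * t j q * t i j * u := by
              rw [← h.bracket i j q hij hpq hiq hR hRq, commutatorElement_def,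
                inv_mul_cancel_right, inv_mul_cancel_right, mul_assoc]
          _ = t j q * (t i q * t i j) * u := by
              rw [(h.comm i q j q hiq hpq hRiq hRq hpq.symm hiq).eq, mul_assoc (t j q)]
          _ = t j q * t i j * (t i q * u) := by
              rw [(h.comm i q i j hiq hij hRiq hR (Ne.symm hiq) hij).eq]; simp only [mul_assoc]
          _ = _ := by rw [e]; simp only [mul_assoc]
      rw [this]
      exact mul_mem_columnCosets hq hpq.symm hRq hRq' (mul_mem (mem_rootSubgroup hij hR ⟨rfl, hi⟩)
        hu') (mem_rootSubgroup hiq hRiq ⟨hpq.symm, hi, hq⟩)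
  by_cases hip : i = p
  · subst hip
    exact h.row_mul_row_mul_column hp hj hq hij hpq hR hRq hRq' hu
  obtain ⟨u', hu', e⟩ := h.mul_column hij hR hi hip hjp hu
  have hk : t i j ∈ rootSubgroup R t (fun i j => j ≠ p ∧ i ∈ T ∧ j ∈ T) :=
    mem_rootSubgroup hij hR ⟨hjp, hi, hj⟩
  by_cases hiq : i = q
  · subst hiq
    have hRpj := h.trans _ _ _ hRq hR
    have : t i j * (t p i * u) = t p j * (t p i * u') * t i j := by
      calc t i j * (t p i * u) = t p j * t p i * t i j * u := by
            rw [← h.bracket_symm hpq hij (Ne.symm hjp) hRq hR, commutatorElement_def,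
              inv_mul_cancel_right, inv_mul_cancel_right, mul_assoc]
        _ = t p j * (t p i * (t i j * u)) := by simp only [mul_assoc]
        _ = _ := by rw [e]; simp only [mul_assoc]
    rw [this]
    exact columnCosets_mul_right (h.row_mul_row_mul_column hp hj hq (Ne.symm hjp) hpq hRpj hRq hRq'
      hu') hk
  · rw [← mul_assoc, (h.comm i j p q hij hpq hR hRq hjp hiq).eq, mul_assoc, e, ← mul_assoc]
    exact mul_mem_columnCosets hq hpq.symm hRq hRq' hu' hk

/-- The set contains `1` and is stable under left multiplication by every generator with indices in
`T`. -/
theorem mem_columnCosets_of_mem (hp : p ∈ T) {g : G}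
    (hg : g ∈ rootSubgroup R t (fun i j => i ∈ T ∧ j ∈ T)) : g ∈ columnCosets R t T p := by
  refine h.rootSubgroup_induction (p := fun g => g ∈ columnCosets R t T p) ?_ ?_ hg
  · rw [← one_mul 1]
    exact mem_columnCosets (one_mem _) (one_mem _)
  · rintro i j hij hR ⟨hi, hj⟩ g - ⟨u, hu, k, hk, rfl | ⟨q, hq, hqp, h1, h2, rfl⟩⟩
    · rw [← mul_assoc]
      exact columnCosets_mul_right (h.mul_mem_columnCosets_of_mem_column hij hR hi hj hu) hk
    · rw [← mul_assoc]
      exact columnCosets_mul_right (h.mul_row_mul_column hp hi hj hq hij hR hqp.symm h1 h2 hu) hk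

/-- The subgroup `H` of the `t i j` with `j ≠ p` is the product of the row subgroup of the `t p j`
and the subgroup of the `t i j` with `i, j ≠ p`. -/
theorem exists_row_mul {T : Finset ι} (hpT : p ∉ T) {g : G}
    (hg : g ∈ rootSubgroup R t (fun i j => j ≠ p ∧ (i = p ∨ i ∈ T) ∧ (j = p ∨ j ∈ T))) :
    ∃ a ∈ rootSubgroup R t (fun i j => i = p ∧ j ∈ T),
      ∃ k ∈ rootSubgroup R t (fun i j => i ∈ T ∧ j ∈ T), g = a * k := by
  refine h.rootSubgroup_induction (p := fun g => ∃ a ∈ rootSubgroup R t (fun i j => i = p ∧ j ∈ T),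
      ∃ k ∈ rootSubgroup R t (fun i j => i ∈ T ∧ j ∈ T), g = a * k)
      ⟨1, one_mem _, 1, one_mem _, (mul_one 1).symm⟩ ?_ hg
  rintro i j hij hR ⟨hjp, hi, hj⟩ g - ⟨a, ha, k, hk, rfl⟩
  replace hj := hj.resolve_left hjp
  by_cases hip : i = p
  · exact ⟨t i j * a, mul_mem (mem_rootSubgroup hij hR ⟨hip, hj⟩) ha, k, hk, (mul_assoc _ _ _).symm⟩
  · replace hi := hi.resolve_left hip
    suffices ∃ a' ∈ rootSubgroup R t (fun i j => i = p ∧ j ∈ T), t i j * a = a' * t i j by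
      obtain ⟨a', ha', e⟩ := this
      exact ⟨a', ha', t i j * k, mul_mem (mem_rootSubgroup hij hR ⟨hi, hj⟩) hk, by
        rw [← mul_assoc, e, mul_assoc]⟩
    refine h.rootSubgroup_normalizes (P := fun k l => k = i ∧ l = j) ?_
      (mem_rootSubgroup hij hR ⟨rfl, rfl⟩) ha
    rintro _ _ k l - hkl h1 h2 ⟨rfl, rfl⟩ ⟨rfl, hl⟩
    refine h.conj_mem hij hkl h1 h2 (mem_rootSubgroup hkl h2 ⟨rfl, hl⟩) (Or.inr hjp)
      (fun e => (hjp e).elim) ?_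
    rintro rfl
    exact mem_rootSubgroup (Ne.symm hjp) (h.trans _ _ _ h2 h1) ⟨rfl, hj⟩

end SteinbergRelations

end CosetDecomposition

/-! ### Faithfulness of transvection representations. -/

namespace SteinbergRelations

open Matrix

variable {ι G : Type*} [Group G] [Fintype ι] [DecidableEq ι] {R : ι → ι → Prop} {t : ι → ι → G}
  {ρ : G →* Matrix ι ι (ZMod 2)} (h : SteinbergRelations R t) (hρ : IsTransvectionRep R t ρ)

include h hρ

/-- In the coset decomposition both `k` and the row element `t p q` fix `e_p`, so `u` fixes it too;
then `u = 1`, and what remains involves no column `p`. -/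
theorem mem_of_fixes_column {T : Finset ι} {p : ι} (hp : p ∈ T) {g : G}
    (hg : g ∈ rootSubgroup R t (fun i j => i ∈ T ∧ j ∈ T))
    (hfix : ρ g *ᵥ Pi.single p 1 = Pi.single p 1) :
    g ∈ rootSubgroup R t (fun i j => j ≠ p ∧ i ∈ T ∧ j ∈ T) := by
  obtain ⟨u, hu, k, hk, e⟩ := h.mem_columnCosets_of_mem hp hg
  have hk' := h.rep_mulVec_single hρ (fun i j hP => hP.1) hk
  rcases e with rfl | ⟨q, hq, hqp, h1, h2, rfl⟩
  · rw [map_mul, ← mulVec_mulVec, hk'] at hfix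
    rw [h.eq_one_of_column hρ T u hu hfix, one_mul]
    exact hk
  · have hq' : t p q ∈ rootSubgroup R t (fun i j => j ≠ p ∧ i ∈ T ∧ j ∈ T) :=
      mem_rootSubgroup hqp.symm h1 ⟨hqp, hp, hq⟩
    have hq'' := h.rep_mulVec_single hρ (fun i j hP => hP.1) hq'
    rw [map_mul, ← mulVec_mulVec, hk', map_mul, ← mulVec_mulVec] at hfix
    have hu' : ρ u *ᵥ Pi.single p 1 = Pi.single p 1 := by
      calc ρ u *ᵥ Pi.single p 1 = (ρ (t p q) * ρ (t p q)) *ᵥ (ρ u *ᵥ Pi.single p 1) := by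
            rw [← map_mul, h.mul_self, map_one, one_mulVec]
        _ = Pi.single p 1 := by rw [← mulVec_mulVec, hfix, hq'']
    rw [h.eq_one_of_column hρ T u hu hu', mul_one]
    exact mul_mem hq' hk

/-- A representation in which the Steinberg generators act as the matrices `1 + E_{i,j}` is
faithful on the subgroup that they generate. -/
theorem eq_one_of_rep_eq_one (T : Finset ι) : ∀ g ∈ rootSubgroup R t (fun i j => i ∈ T ∧ j ∈ T),
    ρ g = 1 → g = 1 := by
  induction T using Finset.induction_on with
  | empty =>
    intro g hg _
    refine h.rootSubgroup_induction (p := fun u => u = 1) rfl ?_ hg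
    simp
  | insert p T hp ih =>
    intro g hg hg1
    have hg' := h.mem_of_fixes_column hρ (Finset.mem_insert_self p T) hg
      (by rw [hg1, one_mulVec])
    simp only [Finset.mem_insert] at hg'
    obtain ⟨a, ha, k, hk, rfl⟩ := h.exists_row_mul hp hg'
    -- From `ρ (a * k) = 1` it follows that `ρ a⁻¹ = ρ k`, whose row `p` is trivial because `k`
    -- involves no index `p`. In the contragredient representation this says that `a`, now a column
    -- element, fixes `e_p`.
    have ha1 : a = 1 := by
      refine h.dual.eq_one_of_column (h.isTransvectionRep_contragredient hρ) (p := p) T a ?_ ?_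
      · refine Subgroup.closure_mono ?_ ha
        rintro _ ⟨i, j, hij, hR, hP, rfl⟩
        exact ⟨j, i, hij.symm, hR, hP, rfl⟩
      · have hak : ρ a⁻¹ = ρ k := by
          calc ρ a⁻¹ = ρ a⁻¹ * ρ (a * k) := by rw [hg1, mul_one]
            _ = ρ k := by rw [← map_mul, inv_mul_cancel_left]
        change (ρ a⁻¹)ᵀ *ᵥ _ = _
        rw [hak, mulVec_single_one]
        ext j
        have := h.rep_mulVec_apply hρ (r := p) (fun i j hP e => hp (e ▸ hP.1)) hk (Pi.single j 1)
        rw [mulVec_single_one] at this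
        simpa [Pi.single_apply, eq_comm] using this
    rw [ha1, one_mul] at hg1 ⊢
    exact ih k hk hg1

end SteinbergRelations

/-! ### From Steinberg relations back to the Coxeter relations. -/

section SteinbergWords

variable {ι G : Type*} [Group G]

namespace SteinbergRelations

variable {R : ι → ι → Prop} {t : ι → ι → G} (h : SteinbergRelations R t)

include h

theorem pair_pow_four {i j k : ι} (hij : i ≠ j) (hjk : j ≠ k) (hik : i ≠ k) (h1 : R i j)
    (h2 : R j k) : (t i j * t j k) ^ 4 = 1 := by
  rw [pow_four_eq_one_iff_mul_self (h.mul_self _ _) (h.mul_self _ _),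
    h.bracket i j k hij hjk hik h1 h2, h.mul_self]

theorem pair_pow_three {i j : ι} (hij : i ≠ j) (h1 : R i j) (h2 : R j i) :
    (t i j * t j i) ^ 3 = 1 :=
  (braid_iff (h.mul_self _ _) (h.mul_self _ _)).2 (h.braid i j hij h1 h2)

theorem triple_pow_three {i j k : ι} (hij : i ≠ j) (hjk : j ≠ k) (hik : i ≠ k) (h1 : R i j)
    (h2 : R j k) (h3 : R j i) : (t i j * t j k * t j i) ^ 3 = 1 := by
  have e := h.bracket i j k hij hjk hik h1 h2
  have h4 := h.trans _ _ _ h1 h2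
  refine (triple_pow_three_iff (h.mul_self _ _) (h.mul_self _ _) (h.mul_self _ _)
    (h.comm j i j k hij.symm hjk h3 h2 hij hjk) (h.pair_pow_three hij h1 h3) ?_).2 ?_ <;> rw [e]
  · exact h.comm i k j k hik hjk h4 h2 hjk.symm hik
  · exact h.bracket j i k hij.symm hik hjk h3 h4

theorem triple_pow_four {i j k l : ι} (hij : i ≠ j) (hjk : j ≠ k) (hkl : k ≠ l) (hik : i ≠ k)
    (hjl : j ≠ l) (hil : i ≠ l) (h1 : R i j) (h2 : R j k) (h3 : R k l) :
    (t i j * t j k * t k l) ^ 4 = 1 := by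
  have e := h.bracket i j k hij hjk hik h1 h2
  have e' := h.bracket j k l hjk hkl hjl h2 h3
  refine (triple_pow_four_iff (h.mul_self _ _) (h.mul_self _ _) (h.mul_self _ _)
    (h.comm i j k l hij hkl h1 h3 hjk hil) ?_ ?_).2 ?_
  · rw [e, h.mul_self]
  · rw [e', h.mul_self]
  · rw [e, e']
    exact h.comm i k j l hik hjl (h.trans _ _ _ h1 h2) (h.trans _ _ _ h2 h3) hjk.symm hil

end SteinbergRelations

/-- For a family of involutions, whether `(a b c) ^ n = 1` depends only on the set `{a, b, c}`. -/
theorem triple_pow_eq_one_of_set_eq {X : Type*} (e : X → G) (he : ∀ a, e a * e a = 1) {n : ℕ}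
    {a b c a' b' c' : X} (hab : a ≠ b) (hac : a ≠ c) (hbc : b ≠ c)
    (hs : ({a, b, c} : Set X) = {a', b', c'}) (h : (e a' * e b' * e c') ^ n = 1) :
    (e a * e b * e c) ^ n = 1 := by
  have rot : ∀ x y z, (e x * e y * e z) ^ n = 1 → (e y * e z * e x) ^ n = 1 := fun x y z hx =>
    mul_pow_eq_one_comm (by rwa [← mul_assoc])
  have rev : ∀ x y z, (e x * e y * e z) ^ n = 1 → (e z * e y * e x) ^ n = 1 := fun x y z hx => by
    rwa [← inv_eq_one, ← inv_pow, mul_inv_rev, mul_inv_rev, inv_eq_self_of_mul_self (he _),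
      inv_eq_self_of_mul_self (he _), inv_eq_self_of_mul_self (he _), ← mul_assoc] at hx
  have h1 := rot _ _ _ h
  have h2 := rot _ _ _ h1
  have h3 := rev _ _ _ h
  have h4 := rev _ _ _ h1
  have h5 := rev _ _ _ h2
  have ha : a ∈ ({a', b', c'} : Set X) := hs ▸ by simp
  have hb : b ∈ ({a', b', c'} : Set X) := hs ▸ by simp
  have hc : c ∈ ({a', b', c'} : Set X) := hs ▸ by simp
  rcases ha with rfl | rfl | rfl <;> rcases hb with rfl | rfl | rfl <;>
    rcases hc with rfl | rfl | rfl <;> first | assumption | contradiction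

end SteinbergWords

/-! ### Elementary matrices and Gaussian elimination within a given support. -/

section ElementaryMatrices

open Matrix

variable {ι : Type*} [Fintype ι] [DecidableEq ι]

/-- The matrix `1 + E_{i,j}` as an element of `GL(𝔽₂)`, for `i ≠ j`. -/
def elementaryGL (i j : ι) : GL ι (ZMod 2) :=
  if h : i = j then 1 else
    ⟨transvection i j 1, transvection i j 1,
      by rw [transvection_mul_transvection_same _ _ h, CharTwo.add_self_eq_zero, transvection_zero],
      by rw [transvection_mul_transvection_same _ _ h, CharTwo.add_self_eq_zero, transvection_zero]⟩

theorem coe_elementaryGL {i j : ι} (h : i ≠ j) :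
    (elementaryGL i j : Matrix ι ι (ZMod 2)) = transvection i j 1 := by
  rw [elementaryGL, dif_neg h]

theorem elementaryGL_mul_self (i j : ι) : elementaryGL i j * elementaryGL i j = 1 := by
  by_cases h : i = j
  · simp [elementaryGL, h]
  · ext1
    rw [Units.val_mul, coe_elementaryGL h, transvection_mul_transvection_same _ _ h,
      CharTwo.add_self_eq_zero, transvection_zero, Units.val_one]

theorem elementaryGL_steinbergRelations {R : ι → ι → Prop}
    (hR : ∀ i j k, R i j → R j k → R i k) : SteinbergRelations R (elementaryGL (ι := ι)) where
  trans := hR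
  mul_self := elementaryGL_mul_self
  comm i j k l hij hkl _ _ hjk hil := by
    ext1
    rw [Units.val_mul, Units.val_mul, coe_elementaryGL hij, coe_elementaryGL hkl]
    simp only [transvection, mul_add, add_mul, one_mul, mul_one,
      single_mul_single_of_ne _ _ _ _ hjk, single_mul_single_of_ne _ _ _ _ hil.symm]
    abel
  bracket i j k hij hjk hik _ _ := by
    rw [commutatorElement_def, mul_inv_eq_iff_eq_mul, mul_inv_eq_iff_eq_mul]
    ext1
    simp only [Units.val_mul, coe_elementaryGL hij, coe_elementaryGL hjk, coe_elementaryGL hik]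
    simp only [transvection, mul_add, add_mul, one_mul, mul_one,
      single_mul_single_same, single_mul_single_of_ne _ _ _ _ hik.symm,
      single_mul_single_of_ne _ _ _ _ hjk.symm, zero_mul]
    abel
  braid i j hij _ _ := by
    ext1
    simp only [Units.val_mul, coe_elementaryGL hij, coe_elementaryGL hij.symm]
    have h1 : ∀ M : Matrix ι ι (ZMod 2), M + M = 0 := fun M => by
      ext a b
      exact CharTwo.add_self_eq_zero _
    simp only [transvection, mul_add, add_mul, one_mul, mul_one,
      single_mul_single_same, single_mul_single_of_ne _ _ _ _ hij,
      single_mul_single_of_ne _ _ _ _ hij.symm]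
    calc _ = 1 + single i j 1 + single j i 1 + single i i 1 + single j j 1 +
          (single i j 1 + single i j (1 : ZMod 2)) := by abel
      _ = 1 + single i j 1 + single j i 1 + single i i 1 + single j j 1 +
          (single j i 1 + single j i (1 : ZMod 2)) := by rw [h1, h1]
      _ = _ := by abel

/-- The invertible matrices that agree with the identity outside the rows and columns in `T`. -/
def trivialOutside (T : Finset ι) : Subgroup (GL ι (ZMod 2)) where
  carrier := {g | ∀ j ∉ T, (g : Matrix ι ι (ZMod 2)) *ᵥ Pi.single j 1 = Pi.single j 1 ∧
    Pi.single j 1 ᵥ* (g : Matrix ι ι (ZMod 2)) = Pi.single j 1}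
  one_mem' j _ := by simp only [Units.val_one, one_mulVec, vecMul_one, and_self]
  mul_mem' {a b} ha hb j hj := by
    rw [Units.val_mul, ← mulVec_mulVec, ← vecMul_vecMul, (hb j hj).1, (ha j hj).1, (ha j hj).2,
      (hb j hj).2]
    exact ⟨rfl, rfl⟩
  inv_mem' {a} ha j hj := by
    constructor
    · nth_rewrite 1 [← (ha j hj).1]
      rw [mulVec_mulVec, ← Units.val_mul, inv_mul_cancel, Units.val_one, one_mulVec]
    · nth_rewrite 1 [← (ha j hj).2]
      rw [vecMul_vecMul, ← Units.val_mul, mul_inv_cancel, Units.val_one, vecMul_one]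

theorem mem_trivialOutside {T : Finset ι} {g : GL ι (ZMod 2)} :
    g ∈ trivialOutside T ↔ ∀ j ∉ T, ∀ i, g i j = (1 : Matrix ι ι (ZMod 2)) i j ∧
      g j i = (1 : Matrix ι ι (ZMod 2)) j i := by
  refine forall₂_congr fun j _ => ?_
  rw [mulVec_single_one, single_one_vecMul, forall_and, funext_iff, funext_iff]
  refine and_congr (forall_congr' fun i => ?_) (forall_congr' fun i => ?_)
  · rw [one_apply, Pi.single_apply]
    rfl
  · rw [one_apply, Pi.single_apply]
    simp only [eq_comm (a := j)]
    rfl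

theorem elementaryGL_mem_trivialOutside {T : Finset ι} {i j : ι} (hi : i ∈ T) (hj : j ∈ T) :
    elementaryGL i j ∈ trivialOutside T := by
  by_cases hij : i = j
  · rw [elementaryGL, dif_pos hij]
    exact one_mem _
  rw [mem_trivialOutside]
  intro k hk l
  have h1 : j ≠ k := by rintro rfl; exact hk hj
  have h2 : i ≠ k := by rintro rfl; exact hk hi
  simp [coe_elementaryGL hij, transvection, h1, h2]

theorem elementaryGL_mul_apply {i j : ι} (hij : i ≠ j) (g : GL ι (ZMod 2)) (a b : ι) :
    (elementaryGL i j * g) a b = if a = i then g i b + g j b else g a b := by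
  rw [Units.val_mul, coe_elementaryGL hij]
  split_ifs with h
  · rw [h, transvection_mul_apply_same, one_mul]
  · rw [transvection_mul_apply_of_ne _ _ _ _ h]

theorem mul_elementaryGL_apply {i j : ι} (hij : i ≠ j) (g : GL ι (ZMod 2)) (a b : ι) :
    (g * elementaryGL i j) a b = if b = j then g a j + g a i else g a b := by
  rw [Units.val_mul, coe_elementaryGL hij]
  split_ifs with h
  · rw [h, mul_transvection_apply_same, one_mul]
  · rw [mul_transvection_apply_of_ne _ _ _ _ h]

variable {R : ι → ι → Prop} {P : Subgroup (GL ι (ZMod 2))}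
  (hP : ∀ g ∈ P, ∀ i j, g i j ≠ 0 → R i j)
  (hP' : ∀ i j, i ≠ j → R i j → elementaryGL i j ∈ P)

theorem ZMod.eq_one_of_ne_zero {a : ZMod 2} (h : a ≠ 0) : a = 1 := by
  revert a
  decide

include hP hP'

/-- Some term `g⁻¹ p k * g k p` of the diagonal entry of `g⁻¹ * g` is nonzero. Since `g⁻¹` also lies
in `P`, its entry gives `R p k`, so adding row `k` to row `p` is permitted and makes the pivot `1`.
-/
theorem exists_diag_eq_one {T : Finset ι} {p : ι} (hp : p ∈ T) {g : GL ι (ZMod 2)}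
    (hg : g ∈ P ⊓ trivialOutside T) :
    ∃ s ∈ rootSubgroup R elementaryGL (fun _ _ => True) ⊓ P ⊓ trivialOutside T,
      (s * g) p p = 1 := by
  by_cases hpp : g p p = 0
  swap
  · exact ⟨1, one_mem _, by rw [one_mul]; exact ZMod.eq_one_of_ne_zero hpp⟩
  have h1 : ((g⁻¹ * g : GL ι (ZMod 2)) : Matrix ι ι (ZMod 2)) p p = 1 := by
    rw [inv_mul_cancel, Units.val_one, one_apply_eq]
  rw [Units.val_mul, mul_apply] at h1
  obtain ⟨k, -, hk⟩ := Finset.exists_ne_zero_of_sum_ne_zero (h1.trans_ne one_ne_zero)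
  have hk1 := left_ne_zero_of_mul hk
  have hk2 := right_ne_zero_of_mul hk
  have hkp : p ≠ k := by rintro rfl; exact hk2 hpp
  have hkT : k ∈ T := by
    by_contra hkT
    rw [(mem_trivialOutside.1 hg.2 k hkT p).2, one_apply_ne hkp.symm] at hk2
    exact hk2 rfl
  have hR := hP _ (inv_mem hg.1) p k hk1
  refine ⟨elementaryGL p k, ⟨⟨mem_rootSubgroup hkp hR trivial, hP' _ _ hkp hR⟩,
    elementaryGL_mem_trivialOutside hp hkT⟩, ?_⟩
  rw [elementaryGL_mul_apply hkp, if_pos rfl, hpp, zero_add, ZMod.eq_one_of_ne_zero hk2]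

/-- A nonzero entry at `(i, p)` itself yields `R i p`, which is the permission for the row operation
that removes it. -/
theorem exists_clear_column {T : Finset ι} {p : ι} (hp : p ∈ T) {g : GL ι (ZMod 2)}
    (hg : g ∈ P ⊓ trivialOutside T) (hpp : g p p = 1) (A : Finset ι) (hA : A ⊆ T) (hpA : p ∉ A) :
    ∃ s ∈ rootSubgroup R elementaryGL (fun _ _ => True) ⊓ P ⊓ trivialOutside T,
      (s * g) p p = 1 ∧ ∀ i ∈ A, (s * g) i p = 0 := by
  induction A using Finset.induction_on with
  | empty => exact ⟨1, one_mem _, by rwa [one_mul], by simp⟩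
  | insert i A hi ih =>
    obtain ⟨s, hs, h1, h2⟩ := ih ((Finset.subset_insert _ _).trans hA)
      fun h => hpA (Finset.mem_insert_of_mem h)
    have hip : i ≠ p := by rintro rfl; exact hpA (Finset.mem_insert_self _ _)
    by_cases h3 : (s * g) i p = 0
    · exact ⟨s, hs, h1, by
        rw [Finset.forall_mem_insert]
        exact ⟨h3, h2⟩⟩
    have hR := hP _ (mul_mem hs.1.2 hg.1) i p h3
    refine ⟨elementaryGL i p * s, mul_mem ⟨⟨mem_rootSubgroup hip hR trivial, hP' _ _ hip hR⟩,
      elementaryGL_mem_trivialOutside (hA (Finset.mem_insert_self _ _)) hp⟩ hs, ?_, ?_⟩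
    · rw [mul_assoc, elementaryGL_mul_apply hip, if_neg hip.symm, h1]
    · intro k hk
      rw [mul_assoc, elementaryGL_mul_apply hip]
      split_ifs with hki
      · rw [h1, ZMod.eq_one_of_ne_zero h3, CharTwo.add_self_eq_zero]
      · exact h2 k ((Finset.mem_insert.1 hk).resolve_left hki)

theorem exists_clear_row {T : Finset ι} {p : ι} (hp : p ∈ T) {g : GL ι (ZMod 2)}
    (hg : g ∈ P ⊓ trivialOutside T) (hpp : ∀ i, g i p = (1 : Matrix ι ι (ZMod 2)) i p)
    (A : Finset ι) (hA : A ⊆ T) (hpA : p ∉ A) :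
    ∃ s ∈ rootSubgroup R elementaryGL (fun _ _ => True) ⊓ P ⊓ trivialOutside T,
      (∀ i, (g * s) i p = (1 : Matrix ι ι (ZMod 2)) i p) ∧ ∀ i ∈ A, (g * s) p i = 0 := by
  induction A using Finset.induction_on with
  | empty => exact ⟨1, one_mem _, by rwa [mul_one], by simp⟩
  | insert i A hi ih =>
    obtain ⟨s, hs, h1, h2⟩ := ih ((Finset.subset_insert _ _).trans hA)
      fun h => hpA (Finset.mem_insert_of_mem h)
    have hip : p ≠ i := by rintro rfl; exact hpA (Finset.mem_insert_self _ _)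
    by_cases h3 : (g * s) p i = 0
    · exact ⟨s, hs, h1, by
        rw [Finset.forall_mem_insert]
        exact ⟨h3, h2⟩⟩
    have hR := hP _ (mul_mem hg.1 hs.1.2) p i h3
    refine ⟨s * elementaryGL p i, mul_mem hs ⟨⟨mem_rootSubgroup hip hR trivial, hP' _ _ hip hR⟩,
      elementaryGL_mem_trivialOutside hp (hA (Finset.mem_insert_self _ _))⟩, ?_, ?_⟩
    · intro k
      rw [← mul_assoc, mul_elementaryGL_apply hip, if_neg hip, h1]
    · intro k hk
      rw [← mul_assoc, mul_elementaryGL_apply hip]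
      split_ifs with hki
      · rw [h1, one_apply_eq, ZMod.eq_one_of_ne_zero h3, CharTwo.add_self_eq_zero]
      · exact h2 k ((Finset.mem_insert.1 hk).resolve_left hki)

/-- Gaussian elimination with pivot `p`: once row and column `p` are those of the identity, the
matrix is nontrivial only on the smaller set `T`. All multipliers used lie in the root subgroup, so
membership passes back to `g`. -/
theorem mem_rootSubgroup_of_mem_trivialOutside (T : Finset ι) : ∀ g ∈ P ⊓ trivialOutside T,
    g ∈ rootSubgroup R elementaryGL (fun _ _ => True) := by
  induction T using Finset.induction_on with
  | empty =>
    intro g hg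
    have : g = 1 := by
      ext i j
      exact (mem_trivialOutside.1 hg.2 j (Finset.notMem_empty j) i).1
    rw [this]
    exact one_mem _
  | insert p T hp ih =>
    intro g hg
    obtain ⟨s1, hs1, h1⟩ := exists_diag_eq_one hP hP' (Finset.mem_insert_self p T) hg
    have hg1 := (P ⊓ trivialOutside (insert p T)).mul_mem ⟨hs1.1.2, hs1.2⟩ hg
    obtain ⟨s2, hs2, h2, h2'⟩ := exists_clear_column hP hP' (Finset.mem_insert_self p T) hg1 h1 T
      (Finset.subset_insert _ _) hp
    have hg2 := (P ⊓ trivialOutside (insert p T)).mul_mem ⟨hs2.1.2, hs2.2⟩ hg1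
    have h3 : ∀ i, (s2 * (s1 * g)) i p = (1 : Matrix ι ι (ZMod 2)) i p := by
      intro i
      by_cases hip : i = p
      · rw [hip, h2, one_apply_eq]
      by_cases hiT : i ∈ T
      · rw [h2' i hiT, one_apply_ne hip]
      · exact (mem_trivialOutside.1 hg2.2 i (by simp [hip, hiT]) p).2
    obtain ⟨s3, hs3, h4, h4'⟩ := exists_clear_row hP hP' (Finset.mem_insert_self p T) hg2 h3 T
      (Finset.subset_insert _ _) hp
    have hg3 := (P ⊓ trivialOutside (insert p T)).mul_mem hg2 ⟨hs3.1.2, hs3.2⟩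
    have h5 : s2 * (s1 * g) * s3 ∈ rootSubgroup R elementaryGL (fun _ _ => True) := by
      refine ih _ ⟨hg3.1, mem_trivialOutside.2 fun j hj i => ?_⟩
      by_cases hjp : j = p
      · subst hjp
        refine ⟨h4 i, ?_⟩
        by_cases hij : i = j
        · rw [hij, h4]
        by_cases hiT : i ∈ T
        · rw [h4' i hiT, one_apply_ne (Ne.symm hij)]
        · exact (mem_trivialOutside.1 hg3.2 i (by simp [hij, hiT]) j).1
      · exact mem_trivialOutside.1 hg3.2 j (by simp [hj, hjp]) i
    rw [Subgroup.mul_mem_cancel_right _ hs3.1.1, Subgroup.mul_mem_cancel_left _ hs2.1.1,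
      Subgroup.mul_mem_cancel_left _ hs1.1.1] at h5
    exact h5

/-- A group of invertible matrices supported on `R` that contains the matrices `1 + E_{i,j}` for
`R i j` is generated by them. -/
theorem eq_rootSubgroup_elementaryGL : P = rootSubgroup R elementaryGL (fun _ _ => True) := by
  refine le_antisymm (fun g hg => ?_) ((Subgroup.closure_le _).2 ?_)
  · exact mem_rootSubgroup_of_mem_trivialOutside hP hP' Finset.univ g
      ⟨hg, fun j hj => (hj (Finset.mem_univ j)).elim⟩
  · rintro _ ⟨i, j, hij, hR, -, rfl⟩
    exact hP' i j hij hR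

end ElementaryMatrices

/-! ### Relations between generators, with missing generators read as `1`. -/

namespace TwoDimCoxeterSystem

variable {X W : Type*} (A : TwoDimCoxeterSystem X) (κ : X → W)

theorem gen_mul_self (s : X) : A.gen s * A.gen s = 1 := by
  rw [← pow_two]
  exact PresentedGroup.one_of_mem (Or.inl (Or.inl ⟨s, rfl⟩))

theorem gen_mul_gen_pow {s s' : X} (h : s ≠ s') : (A.gen s * A.gen s') ^ A.f s s' = 1 :=
  PresentedGroup.one_of_mem (Or.inl (Or.inr ⟨s, s', h, rfl⟩))

theorem gen_mul_gen_mul_gen_pow {a b c : X} (hab : a ≠ b) (hac : a ≠ c) (hbc : b ≠ c) :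
    (A.gen a * A.gen b * A.gen c) ^ A.g a b c = 1 :=
  PresentedGroup.one_of_mem (Or.inr ⟨a, b, c, hab, hac, hbc, rfl⟩)

theorem gen_commute {s s' : X} (h : s ≠ s') (hf : A.f s s' = 2) :
    Commute (A.gen s) (A.gen s') := by
  have := A.gen_mul_gen_pow h
  rwa [hf, pow_two, mul_eq_one_iff_eq_inv, mul_inv_rev,
    inv_eq_self_of_mul_self (A.gen_mul_self _), inv_eq_self_of_mul_self (A.gen_mul_self _)] at this

open scoped Classical in
/-- The generator with index `w`, or `1` if there is none. -/
noncomputable def genAt (w : W) : A.Grp := if h : ∃ s, κ s = w then A.gen h.choose else 1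

variable {κ}

theorem genAt_of_not_exists {w : W} (h : ¬∃ s, κ s = w) : A.genAt κ w = 1 := dif_neg h

theorem exists_genAt_eq {w : W} (h : ∃ s, κ s = w) : ∃ s, κ s = w ∧ A.genAt κ w = A.gen s :=
  ⟨h.choose, h.choose_spec, dif_pos h⟩

theorem genAt_apply (hκ : Function.Injective κ) (s : X) : A.genAt κ (κ s) = A.gen s := by
  obtain ⟨s', h1, h2⟩ := A.exists_genAt_eq ⟨s, rfl⟩
  rw [h2, hκ h1]

theorem genAt_mul_self (w : W) : A.genAt κ w * A.genAt κ w = 1 := by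
  by_cases h : ∃ s, κ s = w
  · obtain ⟨s, -, e⟩ := A.exists_genAt_eq h
    rw [e, gen_mul_self]
  · rw [A.genAt_of_not_exists h, one_mul]

theorem genAt_pow_four (w : W) : A.genAt κ w ^ 4 = 1 := by
  rw [show 4 = 2 * 2 from rfl, pow_mul, pow_two (A.genAt κ w), genAt_mul_self, one_pow]

theorem genAt_commute {w w' : W} (hne : w ≠ w')
    (hf : ∀ s s', κ s = w → κ s' = w' → A.f s s' = 2) :
    Commute (A.genAt κ w) (A.genAt κ w') := by
  by_cases h : ∃ s, κ s = w
  swap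
  · rw [A.genAt_of_not_exists h]
    exact Commute.one_left _
  by_cases h' : ∃ s, κ s = w'
  swap
  · rw [A.genAt_of_not_exists h']
    exact Commute.one_right _
  obtain ⟨s, rfl, e⟩ := A.exists_genAt_eq h
  obtain ⟨s', rfl, e'⟩ := A.exists_genAt_eq h'
  rw [e, e']
  exact A.gen_commute (ne_of_apply_ne κ hne) (hf s s' rfl rfl)

theorem genAt_mul_genAt_pow_four {w w' : W} (hne : w ≠ w')
    (hf : ∀ s s', κ s = w → κ s' = w' → A.f s s' = 4) :
    (A.genAt κ w * A.genAt κ w') ^ 4 = 1 := by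
  by_cases h : ∃ s, κ s = w
  swap
  · rw [A.genAt_of_not_exists h, one_mul, genAt_pow_four]
  by_cases h' : ∃ s, κ s = w'
  swap
  · rw [A.genAt_of_not_exists h', mul_one, genAt_pow_four]
  obtain ⟨s, rfl, e⟩ := A.exists_genAt_eq h
  obtain ⟨s', rfl, e'⟩ := A.exists_genAt_eq h'
  rw [e, e', ← hf s s' rfl rfl]
  exact A.gen_mul_gen_pow (ne_of_apply_ne κ hne)

theorem genAt_mul_genAt_pow_three {w w' : W} (hne : w ≠ w') (h : ∃ s, κ s = w)
    (h' : ∃ s, κ s = w') (hf : ∀ s s', κ s = w → κ s' = w' → A.f s s' = 3) :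
    (A.genAt κ w * A.genAt κ w') ^ 3 = 1 := by
  obtain ⟨s, rfl, e⟩ := A.exists_genAt_eq h
  obtain ⟨s', rfl, e'⟩ := A.exists_genAt_eq h'
  rw [e, e', ← hf s s' rfl rfl]
  exact A.gen_mul_gen_pow (ne_of_apply_ne κ hne)

theorem genAt_triple_pow_three {a b c : W} (hab : a ≠ b) (hac : a ≠ c) (hbc : b ≠ c)
    (ha : ∃ s, κ s = a) (hb : ∃ s, κ s = b) (hc : ∃ s, κ s = c)
    (hg : ∀ r s t, κ r = a → κ s = b → κ t = c → A.g r s t = 3) :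
    (A.genAt κ a * A.genAt κ b * A.genAt κ c) ^ 3 = 1 := by
  obtain ⟨r, rfl, er⟩ := A.exists_genAt_eq ha
  obtain ⟨s, rfl, es⟩ := A.exists_genAt_eq hb
  obtain ⟨t, rfl, et⟩ := A.exists_genAt_eq hc
  rw [er, es, et, ← hg r s t rfl rfl rfl]
  exact A.gen_mul_gen_mul_gen_pow (ne_of_apply_ne κ hab) (ne_of_apply_ne κ hac)
    (ne_of_apply_ne κ hbc)

/-- Replacing a missing letter by `1` does no harm: without an outer letter a word with label 4
remains, and without the middle one a product of two commuting involutions. -/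
theorem genAt_triple_pow_four {a b c : W} (hab : a ≠ b) (hac : a ≠ c) (hbc : b ≠ c)
    (hfab : ∀ s s', κ s = a → κ s' = b → A.f s s' = 4)
    (hfac : ∀ s s', κ s = a → κ s' = c → A.f s s' = 2)
    (hfbc : ∀ s s', κ s = b → κ s' = c → A.f s s' = 4)
    (hg : ∀ r s t, κ r = a → κ s = b → κ t = c → A.g r s t = 4) :
    (A.genAt κ a * A.genAt κ b * A.genAt κ c) ^ 4 = 1 := by
  by_cases ha : ∃ s, κ s = a
  swap
  · rw [A.genAt_of_not_exists ha, one_mul]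
    exact A.genAt_mul_genAt_pow_four hbc hfbc
  by_cases hb : ∃ s, κ s = b
  swap
  · rw [A.genAt_of_not_exists hb, mul_one, (A.genAt_commute hac hfac).mul_pow, genAt_pow_four,
      genAt_pow_four, one_mul]
  by_cases hc : ∃ s, κ s = c
  swap
  · rw [A.genAt_of_not_exists hc, mul_one]
    exact A.genAt_mul_genAt_pow_four hab hfab
  obtain ⟨r, rfl, er⟩ := A.exists_genAt_eq ha
  obtain ⟨s, rfl, es⟩ := A.exists_genAt_eq hb
  obtain ⟨t, rfl, et⟩ := A.exists_genAt_eq hc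
  rw [er, es, et, ← hg r s t rfl rfl rfl]
  exact A.gen_mul_gen_mul_gen_pow (ne_of_apply_ne κ hab) (ne_of_apply_ne κ hac)
    (ne_of_apply_ne κ hbc)

end TwoDimCoxeterSystem

/-! ### The labels of `A_{2,n}` and its subsystems. -/

section Labels

variable {n : ℕ}

/-- The index of a generator of `A_{2,n}` as a natural number, with its kind. -/
def XY.key : XY n → ℕ ⊕ ℕ
  | .x i => .inl i
  | .y i => .inr i

theorem XY.key_injective : Function.Injective (XY.key (n := n)) := by
  rintro (i | i) (j | j) h
  · rw [Fin.ext (Sum.inl.inj h)]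
  · cases h
  · cases h
  · rw [Fin.ext (Sum.inr.inj h)]

theorem XY.eq_x_of_key {a : XY n} {i : ℕ} (h : a.key = .inl i) : ∃ hi : i < n, a = .x ⟨i, hi⟩ := by
  cases a with
  | x j => cases Sum.inl.inj h; exact ⟨j.2, rfl⟩
  | y j => cases h

theorem XY.eq_y_of_key {a : XY n} {i : ℕ} (h : a.key = .inr i) : ∃ hi : i < n, a = .y ⟨i, hi⟩ := by
  cases a with
  | x j => cases h
  | y j => cases Sum.inr.inj h; exact ⟨j.2, rfl⟩

theorem faceLabel_eq_three {a b c : XY n} {i j : Fin n} (hij : (i : ℕ) + 1 = j)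
    (h : ({a, b, c} : Set (XY n)) = {.x i, .x j, .y i} ∨
       ({a, b, c} : Set (XY n)) = {.x i, .x j, .y j} ∨
       ({a, b, c} : Set (XY n)) = {.x i, .y i, .y j} ∨
       ({a, b, c} : Set (XY n)) = {.x j, .y i, .y j}) : faceLabel a b c = 3 :=
  if_pos ⟨i, j, hij, h⟩

theorem faceLabel_eq_four {a b c : XY n} {i j k : Fin n} (hij : (i : ℕ) + 1 = j)
    (hjk : (j : ℕ) + 1 = k)
    (h : ({a, b, c} : Set (XY n)) = {.x i, .x j, .x k} ∨
       ({a, b, c} : Set (XY n)) = {.y i, .y j, .y k}) : faceLabel a b c = 4 := by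
  rw [faceLabel, if_neg, if_pos ⟨i, j, k, hij, hjk, h⟩]
  rintro ⟨p, q, -, h'⟩
  have hx : ∃ r, XY.x r ∈ ({a, b, c} : Set (XY n)) := by
    rcases h' with h' | h' | h' | h' <;> rw [h'] <;> simp
  have hy : ∃ r, XY.y r ∈ ({a, b, c} : Set (XY n)) := by
    rcases h' with h' | h' | h' | h' <;> rw [h'] <;> simp
  rcases h with h | h
  · obtain ⟨r, hr⟩ := hy
    rw [h] at hr
    simp at hr
  · obtain ⟨r, hr⟩ := hx
    rw [h] at hr
    simp at hr

/-- A system obtained from `A_{2,n}` by restricting the labels along an injection. -/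
structure IsSubsystem {X : Type*} (A : TwoDimCoxeterSystem X) (v : X → XY n) : Prop where
  injective : Function.Injective v
  f_eq : ∀ a b, A.f a b = edgeLabel (v a) (v b)
  g_eq : ∀ a b c, A.g a b c = faceLabel (v a) (v b) (v c)

variable {X : Type*} {A : TwoDimCoxeterSystem X} {v : X → XY n}

/-- The indices of the generators `x_i` present in a subsystem. -/
def HasX (v : X → XY n) (i : ℕ) : Prop := ∃ s, (v s).key = .inl i

/-- The indices of the generators `y_i` present in a subsystem. -/
def HasY (v : X → XY n) (i : ℕ) : Prop := ∃ s, (v s).key = .inr i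

variable (A v) in
/-- The generator `x_i` of a subsystem, or `1` if it is missing. -/
noncomputable def genX (i : ℕ) : A.Grp := A.genAt (fun s => (v s).key) (.inl i)

variable (A v) in
/-- The generator `y_i` of a subsystem, or `1` if it is missing. -/
noncomputable def genY (i : ℕ) : A.Grp := A.genAt (fun s => (v s).key) (.inr i)

variable (h : IsSubsystem A v)

include h

theorem IsSubsystem.genX_relations : UnitriangularRelations (genX A v) := by
  have f4 : ∀ i s s', (v s).key = .inl i → (v s').key = .inl (i + 1) → A.f s s' = 4 := by
    intro i s s' h1 h2
    obtain ⟨_, e1⟩ := XY.eq_x_of_key h1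
    obtain ⟨_, e2⟩ := XY.eq_x_of_key h2
    rw [h.f_eq, e1, e2]
    simp [edgeLabel]
  have f2 : ∀ i j s s', i + 1 < j → (v s).key = .inl i → (v s').key = .inl j → A.f s s' = 2 := by
    intro i j s s' hij h1 h2
    obtain ⟨_, e1⟩ := XY.eq_x_of_key h1
    obtain ⟨_, e2⟩ := XY.eq_x_of_key h2
    rw [h.f_eq, e1, e2]
    exact if_neg (by simp only; omega)
  refine ⟨fun i => A.genAt_mul_self _, fun i j hij => ?_, fun i => ?_, fun i => ?_⟩
  · exact A.genAt_commute (by simp; omega) fun s s' => f2 i j s s' hij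
  · exact A.genAt_mul_genAt_pow_four (by simp) (f4 i)
  · refine A.genAt_triple_pow_four (by simp) (by simp) (by simp) (f4 i)
      (fun s s' => f2 i (i + 2) s s' (by omega)) (f4 (i + 1)) fun r s t h1 h2 h3 => ?_
    obtain ⟨_, e1⟩ := XY.eq_x_of_key h1
    obtain ⟨_, e2⟩ := XY.eq_x_of_key h2
    obtain ⟨_, e3⟩ := XY.eq_x_of_key h3
    rw [h.g_eq, e1, e2, e3]
    exact faceLabel_eq_four rfl rfl (Or.inl rfl)

theorem IsSubsystem.genY_relations : UnitriangularRelations (genY A v) := by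
  have f4 : ∀ i s s', (v s).key = .inr i → (v s').key = .inr (i + 1) → A.f s s' = 4 := by
    intro i s s' h1 h2
    obtain ⟨_, e1⟩ := XY.eq_y_of_key h1
    obtain ⟨_, e2⟩ := XY.eq_y_of_key h2
    rw [h.f_eq, e1, e2]
    simp [edgeLabel]
  have f2 : ∀ i j s s', i + 1 < j → (v s).key = .inr i → (v s').key = .inr j → A.f s s' = 2 := by
    intro i j s s' hij h1 h2
    obtain ⟨_, e1⟩ := XY.eq_y_of_key h1
    obtain ⟨_, e2⟩ := XY.eq_y_of_key h2
    rw [h.f_eq, e1, e2]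
    exact if_neg (by simp only; omega)
  refine ⟨fun i => A.genAt_mul_self _, fun i j hij => ?_, fun i => ?_, fun i => ?_⟩
  · exact A.genAt_commute (by simp; omega) fun s s' => f2 i j s s' hij
  · exact A.genAt_mul_genAt_pow_four (by simp) (f4 i)
  · refine A.genAt_triple_pow_four (by simp) (by simp) (by simp) (f4 i)
      (fun s s' => f2 i (i + 2) s s' (by omega)) (f4 (i + 1)) fun r s t h1 h2 h3 => ?_
    obtain ⟨_, e1⟩ := XY.eq_y_of_key h1
    obtain ⟨_, e2⟩ := XY.eq_y_of_key h2
    obtain ⟨_, e3⟩ := XY.eq_y_of_key h3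
    rw [h.g_eq, e1, e2, e3]
    exact faceLabel_eq_four rfl rfl (Or.inr rfl)

theorem IsSubsystem.mixedRelations :
    MixedRelations (genX A v) (genY A v) (HasX v) (HasY v) := by
  refine ⟨h.genX_relations, h.genY_relations, fun i j hij => ?_, fun i hx hy => ?_,
    fun i hx hx' hy => ?_, fun i hx hx' hy => ?_, fun i hx hy hy' => ?_, fun i hx hy hy' => ?_⟩
  · refine A.genAt_commute (by simp) fun s s' h1 h2 => ?_
    obtain ⟨_, e1⟩ := XY.eq_x_of_key h1
    obtain ⟨_, e2⟩ := XY.eq_y_of_key h2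
    rw [h.f_eq, e1, e2]
    exact if_neg (by simpa using hij)
  · refine A.genAt_mul_genAt_pow_three (by simp) hx hy fun s s' h1 h2 => ?_
    obtain ⟨_, e1⟩ := XY.eq_x_of_key h1
    obtain ⟨_, e2⟩ := XY.eq_y_of_key h2
    rw [h.f_eq, e1, e2]
    exact if_pos rfl
  · refine A.genAt_triple_pow_three (by simp) (by simp) (by simp) hx hx' hy
      fun r s t h1 h2 h3 => ?_
    obtain ⟨_, e1⟩ := XY.eq_x_of_key h1
    obtain ⟨_, e2⟩ := XY.eq_x_of_key h2
    obtain ⟨_, e3⟩ := XY.eq_y_of_key h3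
    rw [h.g_eq, e1, e2, e3]
    exact faceLabel_eq_three rfl (Or.inl rfl)
  · refine A.genAt_triple_pow_three (by simp) (by simp) (by simp) hx hx' hy
      fun r s t h1 h2 h3 => ?_
    obtain ⟨_, e1⟩ := XY.eq_x_of_key h1
    obtain ⟨_, e2⟩ := XY.eq_x_of_key h2
    obtain ⟨_, e3⟩ := XY.eq_y_of_key h3
    rw [h.g_eq, e1, e2, e3]
    exact faceLabel_eq_three rfl (Or.inr (Or.inl rfl))
  · refine A.genAt_triple_pow_three (by simp) (by simp) (by simp) hx hy hy'
      fun r s t h1 h2 h3 => ?_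
    obtain ⟨_, e1⟩ := XY.eq_x_of_key h1
    obtain ⟨_, e2⟩ := XY.eq_y_of_key h2
    obtain ⟨_, e3⟩ := XY.eq_y_of_key h3
    rw [h.g_eq, e1, e2, e3]
    exact faceLabel_eq_three rfl (Or.inr (Or.inr (Or.inl rfl)))
  · refine A.genAt_triple_pow_three (by simp) (by simp) (by simp) hx hy hy'
      fun r s t h1 h2 h3 => ?_
    obtain ⟨_, e1⟩ := XY.eq_x_of_key h1
    obtain ⟨_, e2⟩ := XY.eq_y_of_key h2
    obtain ⟨_, e3⟩ := XY.eq_y_of_key h3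
    rw [h.g_eq, e1, e2, e3]
    exact faceLabel_eq_three rfl (Or.inr (Or.inr (Or.inr rfl)))

end Labels

/-! ### Elementary matrices satisfy the Coxeter relations. -/

section MatrixRelations

variable {n : ℕ}

/-- The elementary matrices attached to the generators of `A_{2,n}`, as group elements. -/
def generatorGL : XY n → GLF2 (n + 1)
  | .x i => elementaryGL i.succ i.castSucc
  | .y i => elementaryGL i.castSucc i.succ

theorem coe_generatorGL (a : XY n) :
    (generatorGL a : Matrix (Fin (n + 1)) (Fin (n + 1)) (ZMod 2)) = elementaryMatrix a := by
  cases a with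
  | x i => exact coe_elementaryGL (Fin.castSucc_lt_succ).ne'
  | y i => exact coe_elementaryGL (Fin.castSucc_lt_succ).ne

theorem generatorGL_mul_self (a : XY n) : generatorGL a * generatorGL a = 1 := by
  cases a <;> exact elementaryGL_mul_self _ _

theorem generatorGL_pair {a b : XY n} (hab : a ≠ b) :
    (generatorGL a * generatorGL b) ^ edgeLabel a b = 1 := by
  have H := elementaryGL_steinbergRelations (ι := Fin (n + 1)) (R := fun _ _ => True)
    fun _ _ _ _ _ => trivial
  have comm : Commute (generatorGL a) (generatorGL b) →
      (generatorGL a * generatorGL b) ^ 2 = 1 := fun h => by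
    rw [h.mul_pow, pow_two, pow_two, generatorGL_mul_self, generatorGL_mul_self, one_mul]
  have four : ∀ i j : Fin n, (i : ℕ) + 1 = j →
      (generatorGL (.x i) * generatorGL (.x j)) ^ 4 = 1 ∧
      (generatorGL (.y i) * generatorGL (.y j)) ^ 4 = 1 := fun i j hij => by
    have e : j.castSucc = i.succ := Fin.ext hij.symm
    have n1 : i.castSucc ≠ i.succ := by simp [Fin.ext_iff]
    have n2 : i.succ ≠ j.succ := by simp [Fin.ext_iff]; omega
    have n3 : i.castSucc ≠ j.succ := by simp [Fin.ext_iff]; omega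
    simp only [generatorGL, e]
    exact ⟨H.dual.pair_pow_four n1 n2 n3 trivial trivial, H.pair_pow_four n1 n2 n3 trivial trivial⟩
  have n1 : ∀ i : Fin n, i.castSucc ≠ i.succ := fun i => by simp [Fin.ext_iff]
  rcases a with i | i <;> rcases b with j | j <;> simp only [edgeLabel] <;> split_ifs with hij
  · rcases hij with hij | hij
    · exact (four i j hij).1
    · exact mul_pow_eq_one_comm (four j i hij).1
  · refine comm (H.comm _ _ _ _ (n1 i).symm (n1 j).symm trivial trivial ?_ ?_) <;>
      simp [Fin.ext_iff] <;> omega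
  · subst hij
    exact H.pair_pow_three (n1 i).symm trivial trivial
  · refine comm (H.comm _ _ _ _ (n1 i).symm (n1 j) trivial trivial ?_ ?_) <;> simpa using hij
  · subst hij
    exact H.pair_pow_three (n1 i) trivial trivial
  · refine comm (H.comm _ _ _ _ (n1 i) (n1 j).symm trivial trivial ?_ ?_) <;> simpa using hij
  · rcases hij with hij | hij
    · exact (four i j hij).2
    · exact mul_pow_eq_one_comm (four j i hij).2
  · refine comm (H.comm _ _ _ _ (n1 i) (n1 j) trivial trivial ?_ ?_) <;>
      simp [Fin.ext_iff] <;> omega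

theorem generatorGL_triple {a b c : XY n} (hab : a ≠ b) (hac : a ≠ c) (hbc : b ≠ c) :
    (generatorGL a * generatorGL b * generatorGL c) ^ faceLabel a b c = 1 := by
  have H := elementaryGL_steinbergRelations (ι := Fin (n + 1)) (R := fun _ _ => True)
    fun _ _ _ _ _ => trivial
  unfold faceLabel
  split_ifs with h3 h4
  · obtain ⟨i, j, hij, hs⟩ := h3
    have e : j.castSucc = i.succ := Fin.ext hij.symm
    have n1 : i.castSucc ≠ i.succ := by simp [Fin.ext_iff]
    have n2 : i.succ ≠ j.succ := by simp [Fin.ext_iff]; omega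
    have n3 : i.castSucc ≠ j.succ := by simp [Fin.ext_iff]; omega
    rcases hs with hs | hs | hs | hs
    · refine triple_pow_eq_one_of_set_eq _ generatorGL_mul_self hab hac hbc hs ?_
      simp only [generatorGL, e]
      exact H.dual.triple_pow_three n1 n2 n3 trivial trivial trivial
    -- The triple is reordered to the shape `t i j`, `t j k`, `t j i`, for either the relations or
    -- their dual; the order of the letters does not affect the relation.
    · replace hs : ({a, b, c} : Set (XY n)) = {.x j, .x i, .y j} := by rw [hs, Set.insert_comm]
      refine triple_pow_eq_one_of_set_eq _ generatorGL_mul_self hab hac hbc hs ?_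
      simp only [generatorGL, e]
      exact H.triple_pow_three n2.symm n1.symm n3.symm trivial trivial trivial
    · replace hs : ({a, b, c} : Set (XY n)) = {.y i, .y j, .x i} := by
        rw [hs, Set.insert_comm, Set.pair_comm]
      refine triple_pow_eq_one_of_set_eq _ generatorGL_mul_self hab hac hbc hs ?_
      simp only [generatorGL, e]
      exact H.triple_pow_three n1 n2 n3 trivial trivial trivial
    · replace hs : ({a, b, c} : Set (XY n)) = {.y j, .y i, .x j} := by
        rw [hs, Set.insert_comm, Set.pair_comm, Set.insert_comm]
      refine triple_pow_eq_one_of_set_eq _ generatorGL_mul_self hab hac hbc hs ?_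
      simp only [generatorGL, e]
      exact H.dual.triple_pow_three n2.symm n1.symm n3.symm trivial trivial trivial
  · obtain ⟨i, j, k, hij, hjk, hs⟩ := h4
    have e : j.castSucc = i.succ := Fin.ext hij.symm
    have e' : k.castSucc = j.succ := Fin.ext hjk.symm
    have n1 : i.castSucc ≠ i.succ := by simp [Fin.ext_iff]
    have n2 : i.succ ≠ j.succ := by simp [Fin.ext_iff]; omega
    have n3 : i.castSucc ≠ j.succ := by simp [Fin.ext_iff]; omega
    have n4 : i.castSucc ≠ k.succ := by simp [Fin.ext_iff]; omega
    have n5 : i.succ ≠ k.succ := by simp [Fin.ext_iff]; omega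
    have n6 : j.succ ≠ k.succ := by simp [Fin.ext_iff]; omega
    rcases hs with hs | hs <;>
      refine triple_pow_eq_one_of_set_eq _ generatorGL_mul_self hab hac hbc hs ?_ <;>
      simp only [generatorGL, e, e']
    · exact H.dual.triple_pow_four n1 n2 n6 n3 n5 n4 trivial trivial trivial
    · exact H.triple_pow_four n1 n2 n6 n3 n5 n4 trivial trivial trivial
  · exact pow_zero _

end MatrixRelations

/-! ### The isomorphism with a matrix group. -/

theorem SteinbergRelations.comap {ι ι' G : Type*} [Group G] {R : ι → ι → Prop} {t : ι → ι → G}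
    (h : SteinbergRelations R t) {f : ι' → ι} (hf : Function.Injective f) :
    SteinbergRelations (fun i j => R (f i) (f j)) (fun i j => t (f i) (f j)) where
  trans _ _ _ := h.trans _ _ _
  mul_self _ _ := h.mul_self _ _
  comm _ _ _ _ hij hkl h1 h2 hjk hil := h.comm _ _ _ _ (hf.ne hij) (hf.ne hkl) h1 h2 (hf.ne hjk)
    (hf.ne hil)
  bracket _ _ _ hij hjk hik := h.bracket _ _ _ (hf.ne hij) (hf.ne hjk) (hf.ne hik)
  braid _ _ hij := h.braid _ _ (hf.ne hij)

section Isomorphism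

variable {n : ℕ} {X : Type*} {A : TwoDimCoxeterSystem X} {v : X → XY n}

namespace IsSubsystem

variable (h : IsSubsystem A v)

/-- The homomorphism to `GL` sending each generator to its elementary matrix. -/
def toGL : A.Grp →* GLF2 (n + 1) :=
  PresentedGroup.toGroup (f := fun s => generatorGL (v s)) <| by
    rintro r ((⟨s, rfl⟩ | ⟨s, s', hne, rfl⟩) | ⟨r, s, t, h1, h2, h3, rfl⟩)
    · rw [map_pow, FreeGroup.lift_apply_of, pow_two, generatorGL_mul_self]
    · rw [map_pow, map_mul, FreeGroup.lift_apply_of, FreeGroup.lift_apply_of, h.f_eq]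
      exact generatorGL_pair (h.injective.ne hne)
    · rw [map_pow, map_mul, map_mul, FreeGroup.lift_apply_of, FreeGroup.lift_apply_of,
        FreeGroup.lift_apply_of, h.g_eq]
      exact generatorGL_triple (h.injective.ne h1) (h.injective.ne h2) (h.injective.ne h3)

theorem toGL_gen (s : X) : h.toGL (A.gen s) = generatorGL (v s) :=
  PresentedGroup.toGroup.of _

theorem toGL_genX {i : ℕ} (hi : HasX v i) :
    ∃ hin : i < n, h.toGL (genX A v i) = generatorGL (.x ⟨i, hin⟩) := by
  obtain ⟨s, hs, e⟩ := A.exists_genAt_eq (κ := fun s => (v s).key) hi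
  obtain ⟨hin, e'⟩ := XY.eq_x_of_key hs
  exact ⟨hin, by rw [genX, e, toGL_gen, e']⟩

theorem toGL_genY {i : ℕ} (hi : HasY v i) :
    ∃ hin : i < n, h.toGL (genY A v i) = generatorGL (.y ⟨i, hin⟩) := by
  obtain ⟨s, hs, e⟩ := A.exists_genAt_eq (κ := fun s => (v s).key) hi
  obtain ⟨hin, e'⟩ := XY.eq_y_of_key hs
  exact ⟨hin, by rw [genY, e, toGL_gen, e']⟩

theorem toGL_rootElement_genY {i j : ℕ} (hij : i < j) (hj : j < n + 1)
    (hy : ∀ k, i ≤ k → k < j → HasY v k) :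
    h.toGL (rootElement (genY A v) i j) = elementaryGL ⟨i, hij.trans hj⟩ ⟨j, hj⟩ := by
  induction j, hij using Nat.le_induction with
  | base =>
    rw [rootElement_succ_self]
    exact (h.toGL_genY (hy i le_rfl (Nat.lt_succ_self i))).2
  | succ j hij ih =>
    obtain ⟨hjn, e⟩ := h.toGL_genY (hy j (Nat.le_of_succ_le hij) (Nat.lt_succ_self j))
    rw [rootElement_succ hij, map_commutatorElement, e,
      ih (by omega) fun k h1 h2 => hy k h1 (by omega)]
    refine (elementaryGL_steinbergRelations (R := fun _ _ => True)
      fun _ _ _ _ _ => trivial).bracket _ _ _ ?_ ?_ ?_ trivial trivial <;>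
      simp [Fin.ext_iff] <;> omega

theorem toGL_rootElement_genX {i j : ℕ} (hij : i < j) (hj : j < n + 1)
    (hx : ∀ k, i ≤ k → k < j → HasX v k) :
    h.toGL (rootElement (genX A v) i j) = elementaryGL ⟨j, hj⟩ ⟨i, hij.trans hj⟩ := by
  induction j, hij using Nat.le_induction with
  | base =>
    rw [rootElement_succ_self]
    exact (h.toGL_genX (hx i le_rfl (Nat.lt_succ_self i))).2
  | succ j hij ih =>
    obtain ⟨hjn, e⟩ := h.toGL_genX (hx j (Nat.le_of_succ_le hij) (Nat.lt_succ_self j))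
    rw [rootElement_succ hij, map_commutatorElement, e,
      ih (by omega) fun k h1 h2 => hx k h1 (by omega)]
    refine (elementaryGL_steinbergRelations (R := fun _ _ => True)
      fun _ _ _ _ _ => trivial).bracket_symm ?_ ?_ ?_ trivial trivial <;>
      simp [Fin.ext_iff] <;> omega

/-- The relation on matrix positions that describes the support of the image of a subsystem. -/
def _root_.supportRel (v : X → XY n) (i j : Fin (n + 1)) : Prop :=
  PathRel (HasX v) (HasY v) i j

variable (A v) in
/-- The element of the group of a subsystem corresponding to `1 + E_{i,j}`. -/
noncomputable def _root_.subsystemElement (i j : Fin (n + 1)) : A.Grp :=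
  transvectionElement (genX A v) (genY A v) i j

include h in
theorem steinbergRelations : SteinbergRelations (supportRel v) (subsystemElement A v) :=
  h.mixedRelations.steinbergRelations.comap Fin.val_injective

theorem toGL_subsystemElement {i j : Fin (n + 1)} (hij : i ≠ j) (hR : supportRel v i j) :
    h.toGL (subsystemElement A v i j) = elementaryGL i j := by
  rcases lt_or_gt_of_ne (Fin.val_injective.ne hij) with hlt | hlt
  · rw [subsystemElement, transvectionElement_of_lt hlt]
    exact h.toGL_rootElement_genY hlt j.2 hR.1
  · rw [subsystemElement, transvectionElement_of_gt hlt]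
    exact h.toGL_rootElement_genX hlt i.2 hR.2

include h in
theorem exists_gen_eq (s : X) :
    ∃ i j, i ≠ j ∧ supportRel v i j ∧ subsystemElement A v i j = A.gen s := by
  have hk : Function.Injective fun s => (v s).key := XY.key_injective.comp h.injective
  cases hs : v s with
  | x i =>
    have hs' : (v s).key = .inl (i : ℕ) := by rw [hs]; rfl
    refine ⟨i.succ, i.castSucc, (Fin.castSucc_lt_succ).ne', ⟨fun k h1 h2 => ?_,
      fun k h1 h2 => ?_⟩, ?_⟩
    · simp at h1 h2; omega
    · simp at h1 h2
      obtain rfl : k = i := by omega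
      exact ⟨s, hs'⟩
    · rw [subsystemElement, transvectionElement_of_gt (by simp), Fin.val_succ, Fin.val_castSucc,
        rootElement_succ_self, genX, ← hs']
      exact A.genAt_apply hk s
  | y i =>
    have hs' : (v s).key = .inr (i : ℕ) := by rw [hs]; rfl
    refine ⟨i.castSucc, i.succ, (Fin.castSucc_lt_succ).ne, ⟨fun k h1 h2 => ?_,
      fun k h1 h2 => ?_⟩, ?_⟩
    · simp at h1 h2
      obtain rfl : k = i := by omega
      exact ⟨s, hs'⟩
    · simp at h1 h2; omega
    · rw [subsystemElement, transvectionElement_of_lt (by simp), Fin.val_succ, Fin.val_castSucc,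
        rootElement_succ_self, genY, ← hs']
      exact A.genAt_apply hk s

include h in
theorem rootSubgroup_eq_top :
    rootSubgroup (supportRel v) (subsystemElement A v) (fun _ _ => True) = ⊤ := by
  rw [eq_top_iff, ← PresentedGroup.closure_range_of A.relators]
  refine (Subgroup.closure_le _).2 ?_
  rintro _ ⟨s, rfl⟩
  obtain ⟨i, j, hij, hR, e⟩ := h.exists_gen_eq s
  change A.gen s ∈ _
  rw [← e]
  exact mem_rootSubgroup hij hR trivial

/-- Matrices with index set `Fin (n + 1)` give a transvection representation of the whole group,
because the root elements generate it; such a representation is faithful. -/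
theorem toGL_injective : Function.Injective h.toGL := by
  rw [injective_iff_map_eq_one]
  intro g hg
  refine h.steinbergRelations.eq_one_of_rep_eq_one
    (ρ := (Units.coeHom (Matrix (Fin (n + 1)) (Fin (n + 1)) (ZMod 2))).comp h.toGL)
    (fun i j hij hR => ?_) Finset.univ g ?_ ?_
  · rw [MonoidHom.comp_apply, h.toGL_subsystemElement hij hR]
    exact coe_elementaryGL hij
  · simp only [Finset.mem_univ, and_self]
    rw [h.rootSubgroup_eq_top]
    trivial
  · rw [MonoidHom.comp_apply, hg, map_one]

/-- Both groups are generated by the elementary matrices at the positions in `supportRel v`: the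
image because root elements map to them, `P` by Gaussian elimination. -/
theorem range_toGL {P : Subgroup (GLF2 (n + 1))}
    (hP : ∀ g : GLF2 (n + 1), g ∈ P ↔ ∀ i j, g i j ≠ 0 → supportRel v i j) : h.toGL.range = P := by
  have hP' : ∀ i j, i ≠ j → supportRel v i j → elementaryGL i j ∈ P := fun i j hij hR => by
    refine (hP _).2 fun a b hab => ?_
    rw [coe_elementaryGL hij] at hab
    by_cases hne : a = b
    · subst hne
      exact ⟨by omega, by omega⟩
    · by_cases hab' : i = a ∧ j = b
      · rwa [← hab'.1, ← hab'.2]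
      · refine (hab ?_).elim
        rw [Matrix.transvection, Matrix.add_apply, Matrix.one_apply_ne hne, zero_add,
          Matrix.single_apply, if_neg hab']
  rw [eq_rootSubgroup_elementaryGL (fun g hg => (hP g).1 hg) hP', MonoidHom.range_eq_map,
    ← h.rootSubgroup_eq_top, rootSubgroup, rootSubgroup, MonoidHom.map_closure]
  congr 1
  ext g
  constructor
  · rintro ⟨_, ⟨i, j, hij, hR, -, rfl⟩, rfl⟩
    exact ⟨i, j, hij, hR, trivial, (h.toGL_subsystemElement hij hR).symm⟩
  · rintro ⟨i, j, hij, hR, -, rfl⟩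
    exact ⟨_, ⟨i, j, hij, hR, trivial, rfl⟩, h.toGL_subsystemElement hij hR⟩

include h in
theorem exists_mulEquiv {P : Subgroup (GLF2 (n + 1))}
    (hP : ∀ g : GLF2 (n + 1), g ∈ P ↔ ∀ i j, g i j ≠ 0 → supportRel v i j) :
    ∃ e : A.Grp ≃* P, ∀ s, ((e (A.gen s) : GLF2 (n + 1)) :
      Matrix (Fin (n + 1)) (Fin (n + 1)) (ZMod 2)) = elementaryMatrix (v s) := by
  refine ⟨(MonoidHom.ofInjective h.toGL_injective).trans
    (MulEquiv.subgroupCongr (h.range_toGL hP)), fun s => ?_⟩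
  rw [← coe_generatorGL, ← h.toGL_gen]
  rfl

end IsSubsystem

end Isomorphism

/-! ### Numberings of depth three. -/

section Locality

variable {n : ℕ}

/-- The position of a generator in the order `x_1, y_1, x_2, y_2, …`. -/
def XY.position : XY n → ℕ
  | .x i => 2 * i
  | .y i => 2 * i + 1

theorem XY.position_injective : Function.Injective (XY.position (n := n)) := by
  rintro (i | i) (j | j) hij <;> simp only [XY.position] at hij
  · rw [Fin.ext (by omega : (i : ℕ) = j)]
  · omega
  · omega
  · rw [Fin.ext (by omega : (i : ℕ) = j)]

theorem edgeLabel_eq_two_of_position {a b : XY n} (hab : a.position + 3 ≤ b.position) :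
    edgeLabel a b = 2 := by
  rcases a with i | i <;> rcases b with j | j <;> simp only [XY.position] at hab <;>
    refine if_neg ?_
  · omega
  · rintro rfl; omega
  · rintro rfl; omega
  · omega

instance : Finite (XY n) :=
  Finite.of_injective (β := Fin n ⊕ Fin n)
    (fun a => match a with | .x i => .inl i | .y i => .inr i) <| by
      rintro (i | i) (j | j) h <;> simp_all

theorem elementaryMatrix_injective : Function.Injective (elementaryMatrix (n := n)) := by
  have key : ∀ p q p' q' : Fin (n + 1), 1 + Matrix.single p q (1 : ZMod 2) =
      1 + Matrix.single p' q' 1 → p' = p ∧ q' = q := fun p q p' q' h => by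
    have h' := congrFun (congrFun h p) q
    rw [Matrix.add_apply, Matrix.add_apply, add_right_inj] at h'
    rw [Matrix.single_apply_same, Matrix.single_apply] at h'
    by_contra hne
    rw [if_neg hne] at h'
    exact one_ne_zero h'
  rintro (i | i) (j | j) h <;> obtain ⟨h1, h2⟩ := key _ _ _ _ h <;>
    simp only [Fin.ext_iff, Fin.val_succ, Fin.val_castSucc] at h1 h2
  · rw [Fin.ext h2]
  · omega
  · omega
  · rw [Fin.ext h1]

theorem StrictMono.add_le_apply {r : ℕ} {f : Fin r → ℕ} (hf : StrictMono f) {i j : Fin r} {k : ℕ}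
    (h : (i : ℕ) + k ≤ j) : f i + k ≤ f j := by
  induction k generalizing j with
  | zero => exact hf.monotone h
  | succ k ih =>
    have hj : (j : ℕ) - 1 < r := by omega
    have h1 := ih (j := ⟨j - 1, hj⟩) (by simp only; omega)
    have h2 := hf (a := ⟨j - 1, hj⟩) (b := j) (by rw [Fin.lt_def]; simp only; omega)
    omega

/-- The generators present are numbered by increasing position. Omitting some of them never makes a
difference of positions smaller than the difference of indices, so depth three persists; the
generators are distinct because their matrices are. -/
theorem IsSubsystem.isLocalOfDepth {X : Type*} {A : TwoDimCoxeterSystem X} {v : X → XY n}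
    (h : IsSubsystem A v) : A.IsLocalOfDepth 3 := by
  have hinj : Function.Injective fun s => (v s).position :=
    XY.position_injective.comp h.injective
  have : Finite X := Finite.of_injective v h.injective
  have := Fintype.ofFinite X
  let _ : LinearOrder X := LinearOrder.lift' (fun s => (v s).position) hinj
  have hmono : StrictMono fun s => (v s).position := fun a b hab => hab
  let σ := Fintype.orderIsoFinOfCardEq X rfl
  refine ⟨_, σ.toEquiv, ?_, ?_, fun i j hij => ?_⟩
  · intro i j hij
    have := congrArg (fun g => (h.toGL g : Matrix (Fin (n + 1)) (Fin (n + 1)) (ZMod 2))) hij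
    simp only [h.toGL_gen, coe_generatorGL] at this
    exact σ.injective (h.injective (elementaryMatrix_injective this))
  · rw [← PresentedGroup.closure_range_of A.relators]
    congr 1
    exact σ.toEquiv.surjective.range_comp (PresentedGroup.of (rels := A.relators))
  · have hpos := (hmono.comp σ.strictMono).add_le_apply hij
    refine A.gen_commute (fun e => ?_) ((h.f_eq _ _).trans (edgeLabel_eq_two_of_position hpos))
    have := σ.injective e
    omega

end Locality

/-! ### Parabolic and unitriangular subgroups as support conditions. -/

section Parabolics

variable {m : ℕ}

/-- Two positions lie in different blocks exactly when a block boundary separates them. With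
positions counted from `0`, the stopover `k + 1` is the boundary between `k` and `k + 1`. -/
theorem Composition.index_lt_index_iff (lam : Composition m) {i j : Fin m} :
    lam.index i < lam.index j ↔ ∃ k, (i : ℕ) ≤ k ∧ k < j ∧ k + 1 ∈ stopovers lam := by
  constructor
  · intro h
    have h1 : lam.sizeUpTo (lam.index i + 1) ≤ lam.sizeUpTo (lam.index j) :=
      lam.monotone_sizeUpTo h
    have h2 : (i : ℕ) < lam.sizeUpTo (lam.index i + 1) := lam.lt_sizeUpTo_index_succ i
    have h3 := lam.sizeUpTo_index_le j
    have h4 : 1 ≤ (lam.index j : ℕ) := Nat.one_le_of_lt h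
    -- The boundary chosen is the left end of the block of `j`.
    refine ⟨lam.sizeUpTo (lam.index j) - 1, ?_, ?_, lam.index j, h4, (lam.index j).2, ?_⟩ <;> omega
  · rintro ⟨k, h1, h2, l, h3, h4, h5⟩
    have h6 : (lam.index i : ℕ) < l := by
      by_contra hl
      have := lam.monotone_sizeUpTo (not_lt.1 hl)
      have := lam.sizeUpTo_index_le i
      omega
    have h7 : l ≤ lam.index j := by
      by_contra hl
      have h8 : lam.sizeUpTo (lam.index j + 1) ≤ lam.sizeUpTo l :=
        lam.monotone_sizeUpTo (not_le.1 hl)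
      have : (j : ℕ) < lam.sizeUpTo (lam.index j + 1) := lam.lt_sizeUpTo_index_succ j
      omega
    exact Fin.lt_def.2 (by omega)

theorem mem_transposeSubgroup {H : Subgroup (GLF2 m)} {g : GLF2 m} {p : Matrix (Fin m) (Fin m)
    (ZMod 2) → Prop} (hp : ∀ h : GLF2 m, h ∈ H ↔ p h) :
    g ∈ transposeSubgroup H ↔ p (g : Matrix (Fin m) (Fin m) (ZMod 2)).transpose := by
  constructor
  · rintro ⟨h, hh, e⟩
    rw [e, Matrix.transpose_transpose]
    exact (hp h).1 hh
  · intro hg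
    refine ⟨⟨(g : Matrix (Fin m) (Fin m) (ZMod 2)).transpose,
      ((g⁻¹ : GLF2 m) : Matrix (Fin m) (Fin m) (ZMod 2)).transpose, ?_, ?_⟩, (hp _).2 hg,
      (Matrix.transpose_transpose _).symm⟩
    · rw [← Matrix.transpose_mul, ← Units.val_mul, inv_mul_cancel, Units.val_one,
        Matrix.transpose_one]
    · rw [← Matrix.transpose_mul, ← Units.val_mul, mul_inv_cancel, Units.val_one,
        Matrix.transpose_one]

theorem mem_parabolicInter {lam mu : Composition m} {g : GLF2 m} :
    g ∈ parabolicInter lam mu ↔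
      ∀ i j, g i j ≠ 0 → ¬lam.index j < lam.index i ∧ ¬mu.index i < mu.index j := by
  rw [parabolicInter, Subgroup.mem_inf,
    mem_transposeSubgroup (p := fun M => M.BlockTriangular mu.index) fun _ => Iff.rfl]
  constructor
  · rintro ⟨h1, h2⟩ i j hij
    exact ⟨fun h => hij (h1 h), fun h => hij (h2 h)⟩
  · intro h
    exact ⟨fun i j hij => by_contra fun h' => (h i j h').1 hij,
      fun i j hij => by_contra fun h' => (h j i h').2 hij⟩

variable {n : ℕ}

theorem isSubsystem_restrict (S : Set (XY n)) :
    IsSubsystem ((coxeterA2 n).restrict S) (Subtype.val : S → XY n) :=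
  ⟨Subtype.val_injective, fun _ _ => rfl, fun _ _ _ => rfl⟩

theorem isSubsystem_id : IsSubsystem (coxeterA2 n) id :=
  ⟨Function.injective_id, fun _ _ => rfl, fun _ _ _ => rfl⟩

theorem hasX_stopoverFree {lam mu : Composition (n + 1)} {k : ℕ} (hk : k < n) :
    HasX (Subtype.val : stopoverFree lam mu → XY n) k ↔ k + 1 ∉ stopovers lam := by
  constructor
  · rintro ⟨⟨s, ⟨i, hi, rfl⟩ | ⟨i, hi, rfl⟩⟩, e⟩
    · cases Sum.inl.inj e
      exact hi
    · cases e
  · intro h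
    exact ⟨⟨.x ⟨k, hk⟩, Or.inl ⟨_, h, rfl⟩⟩, rfl⟩

theorem hasY_stopoverFree {lam mu : Composition (n + 1)} {k : ℕ} (hk : k < n) :
    HasY (Subtype.val : stopoverFree lam mu → XY n) k ↔ k + 1 ∉ stopovers mu := by
  constructor
  · rintro ⟨⟨s, ⟨i, hi, rfl⟩ | ⟨i, hi, rfl⟩⟩, e⟩
    · cases e
    · cases Sum.inr.inj e
      exact hi
  · intro h
    exact ⟨⟨.y ⟨k, hk⟩, Or.inr ⟨_, h, rfl⟩⟩, rfl⟩

/-- An upward path from `i` to `j` uses the `y`'s and is blocked by stopovers of `mu`, a downward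
one uses the `x`'s and is blocked by stopovers of `lam`. -/
theorem supportRel_stopoverFree {lam mu : Composition (n + 1)} {i j : Fin (n + 1)} :
    supportRel (Subtype.val : stopoverFree lam mu → XY n) i j ↔
      ¬lam.index j < lam.index i ∧ ¬mu.index i < mu.index j := by
  rw [and_comm, Composition.index_lt_index_iff, Composition.index_lt_index_iff]
  push Not
  refine and_congr (forall_congr' fun k => forall₂_congr fun _ h => ?_)
    (forall_congr' fun k => forall₂_congr fun _ h => ?_)
  · exact hasY_stopoverFree (by omega)
  · exact hasX_stopoverFree (by omega)

theorem supportRel_id (i j : Fin (n + 1)) : supportRel (id : XY n → XY n) i j :=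
  ⟨fun k _ h => ⟨.y ⟨k, by omega⟩, rfl⟩, fun k _ h => ⟨.x ⟨k, by omega⟩, rfl⟩⟩

theorem supportRel_range_y {i j : Fin (n + 1)} :
    supportRel (Subtype.val : Set.range (XY.y (n := n)) → XY n) i j ↔ i ≤ j := by
  constructor
  · intro h
    by_contra hij
    obtain ⟨⟨_, k, rfl⟩, e⟩ := h.2 j le_rfl (not_le.1 hij)
    cases e
  · intro h
    exact ⟨fun k _ h => ⟨⟨.y ⟨k, by omega⟩, _, rfl⟩, rfl⟩, fun k h1 h2 => by omega⟩

/-- Over `𝔽₂` the diagonal condition is automatic: the determinant of an upper triangular matrix is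
the product of its diagonal entries, so invertibility makes each of them `1`. -/
theorem mem_upperUnitriangular {g : GLF2 m} :
    g ∈ upperUnitriangular m ↔ ∀ i j, g i j ≠ 0 → i ≤ j := by
  constructor
  · intro h i j hij
    by_contra hlt
    exact hij (h.1 i j (not_le.1 hlt))
  · intro h
    have h1 : ∀ i j : Fin m, j < i → g i j = 0 := fun i j hij => by
      by_contra h'
      exact (h i j h').not_gt hij
    refine ⟨h1, fun i => ZMod.eq_one_of_ne_zero fun hi => ?_⟩
    have hdet : (g : Matrix (Fin m) (Fin m) (ZMod 2)).det = 0 := by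
      rw [Matrix.det_of_isUpperTriangular fun i j hij => h1 i j hij]
      exact Finset.prod_eq_zero (Finset.mem_univ i) hi
    have := (Matrix.isUnit_iff_isUnit_det _).1 g.isUnit
    rw [hdet] at this
    exact not_isUnit_zero this

end Parabolics

theorem mainTheorem1 (n : ℕ) :
    (∀ lam mu : Composition (n + 1),
      (∃ e : ((coxeterA2 n).restrict (stopoverFree lam mu)).Grp ≃* parabolicInter lam mu,
        ∀ s : stopoverFree lam mu,
          ((e (((coxeterA2 n).restrict (stopoverFree lam mu)).gen s) : GLF2 (n + 1)) :
            Matrix (Fin (n + 1)) (Fin (n + 1)) (ZMod 2)) = elementaryMatrix (s : XY n)) ∧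
      ((coxeterA2 n).restrict (stopoverFree lam mu)).IsLocalOfDepth 3) ∧
    ((∃ e : (coxeterA2 n).Grp ≃* GLF2 (n + 1),
        ∀ s : XY n,
          (e ((coxeterA2 n).gen s) : Matrix (Fin (n + 1)) (Fin (n + 1)) (ZMod 2)) =
            elementaryMatrix s) ∧
      (coxeterA2 n).IsLocalOfDepth 3) ∧
    ((∃ e : ((coxeterA2 n).restrict (Set.range XY.y)).Grp ≃* upperUnitriangular (n + 1),
        ∀ s : (Set.range XY.y : Set (XY n)),
          ((e (((coxeterA2 n).restrict (Set.range XY.y)).gen s) : GLF2 (n + 1)) :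
            Matrix (Fin (n + 1)) (Fin (n + 1)) (ZMod 2)) = elementaryMatrix (s : XY n)) ∧
      ((coxeterA2 n).restrict (Set.range XY.y)).IsLocalOfDepth 3) := by
  refine ⟨fun lam mu => ⟨?_, (isSubsystem_restrict _).isLocalOfDepth⟩,
    ⟨?_, isSubsystem_id.isLocalOfDepth⟩, ?_, (isSubsystem_restrict _).isLocalOfDepth⟩
  · refine (isSubsystem_restrict _).exists_mulEquiv fun g => ?_
    rw [mem_parabolicInter]
    exact forall₂_congr fun i j => imp_congr_right fun _ => supportRel_stopoverFree.symm
  -- With every generator present the support condition is always satisfied, so the matrix group is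
  -- all of `GL`.
  · obtain ⟨e, he⟩ := isSubsystem_id.exists_mulEquiv (n := n) (P := ⊤)
      fun g => iff_of_true trivial fun i j _ => supportRel_id i j
    exact ⟨e.trans Subgroup.topEquiv, he⟩
  · refine (isSubsystem_restrict _).exists_mulEquiv fun g => ?_
    rw [mem_upperUnitriangular]
    exact forall₂_congr fun i j => imp_congr_right fun _ => supportRel_range_y.symm
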